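/- Let $\mathbb{K}$ be a field, let $G$ be a group, and let $V=\bigoplus_{g\in G}V_g$ and $W=\bigoplus_{g\in G}W_g$ be (not necessarily finite-dimensional) Yetter--Drinfeld modules over $G$, i.e. $\mathbb{K}G$-modules with $hV_g\subseteq V_{hgh^{-1}}$ and $hW_g\subseteq W_{hgh^{-1}}$ for all $g,h\in G$. Let $\mathrm{supp}\,V=\{g\in G\mid V_g\neq 0\}$, a quandle with the operation $x\triangleright y=xyx^{-1}$. In the Nichols algebra $\mathcal{B}(V\oplus W)$ let $(\mathrm{ad}\,V)^0(W)=W$, and let $(\mathrm{ad}\,V)^{n+1}(W)$ be the linear span of the elements $(\mathrm{ad}\,v)(y)=vy-(g\cdot y)v$ with $g\in G$, $v\in V_g$ and $y\in(\mathrm{ad}\,V)^n(W)$. Assume that $\mathrm{supp}\,V$ is an indecomposable quandle, i.e. it is non-empty and its inner group (the group generated by the permutations $y\mapsto x\triangleright y$ with $x\in\mathrm{supp}\,V$) acts transitively on it. Assume further that $(\mathrm{ad}\,V)(W)\neq 0$ and $(\mathrm{ad}\,V)^4(W)=0$. Then $\mathrm{supp}\,V$ is isomorphic, as a quandle, to one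 of $$\{1\},\quad (12)^{\mathbb{S}_3},\quad (12)^{\mathbb{S}_4},\quad (123)^{\mathbb{A}_4},\quad \mathrm{Aff}(5,2),\quad \mathrm{Aff}(5,3),\quad \mathrm{Aff}(5,4),\quad (1234)^{\mathbb{S}_4}.$$ Here $g^H$ denotes the conjugacy class of $g$ in the group $H$ with the operation $x\triangleright y=xyx^{-1}$, $\mathrm{Aff}(5,a)$ denotes the set $\mathbb{Z}/5\mathbb{Z}$ with $x\triangleright y=(1-a)x+ay$, and $\{1\}$ denotes the one-point quandle. -/

import Mathlib

open scoped DirectSum Quandles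

/-! ### Quandles -/

/-- The inner group of a quandle `X`: the group of permutations of `X` generated by the
left translations `y ↦ x ◃ y`. -/
def Inn (X : Type*) [Quandle X] : Subgroup (Equiv.Perm X) :=
  Subgroup.closure (Set.range fun x : X => Rack.act' x)

/-- A (non-empty) quandle is indecomposable if its inner group acts transitively on it. -/
def IsIndecomposable (X : Type*) [Quandle X] : Prop :=
  Nonempty X ∧ ∀ x y : X, ∃ f ∈ Inn X, f x = y

/-- Two quandles are isomorphic if there is a bijection compatible with the operations. -/
def QuandleIso (X Y : Type*) [Quandle X] [Quandle Y] : Prop :=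
  ∃ e : X ≃ Y, ∀ x y : X, e (x ◃ y) = e x ◃ e y

/-- The quandle structure `x ◃ y = x * y * x⁻¹` on a conjugation-stable subset of a group. -/
abbrev conjQuandle {G : Type*} [Group G] (S : Set G)
    (hS : ∀ g, ∀ s ∈ S, g * s * g⁻¹ ∈ S) : Quandle S where
  act x y := ⟨x * y * (x : G)⁻¹, hS _ _ y.2⟩
  invAct x y := ⟨(x : G)⁻¹ * y * x, by simpa using hS (x : G)⁻¹ _ y.2⟩
  self_distrib := by intro x y z; ext; simp [mul_assoc]
  left_inv x y := by ext; simp [mul_assoc]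
  right_inv x y := by ext; simp [mul_assoc]
  fix := by intro x; ext; simp

/-- The conjugacy class `g^G` of `g` in `G`, viewed as a quandle under conjugation. -/
def ConjClassQuandle {G : Type*} [Group G] (g : G) : Type _ := {x : G | IsConj g x}

instance {G : Type*} [Group G] (g : G) : Quandle (ConjClassQuandle g) :=
  conjQuandle {x : G | IsConj g x} fun h _ hs => hs.trans (isConj_iff.2 ⟨h, rfl⟩)

/-- The 3-cycle `0 ↦ 1 ↦ 2 ↦ 0` in the alternating group on `{0, 1, 2, 3}`. -/
def threeCycleA4 : alternatingGroup (Fin 4) :=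
  ⟨Equiv.swap 0 1 * Equiv.swap 1 2, Equiv.Perm.mem_alternatingGroup.2 (by decide)⟩

/-- The affine (Alexander) quandle `Aff(n, a)`, with underlying set `ℤ/n`. -/
def Aff (n : ℕ) (_ : (ZMod n)ˣ) : Type := ZMod n

/-- The operation `x ◃ y = (1 - a) x + a y` of `Aff(n, a)`. -/
def affAct (n : ℕ) (a : (ZMod n)ˣ) (x y : ZMod n) : ZMod n := (1 - a) * x + a * y

/-- The inverse operation of `affAct`. -/
def affInvAct (n : ℕ) (a : (ZMod n)ˣ) (x y : ZMod n) : ZMod n :=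
  (a⁻¹ : (ZMod n)ˣ) * (y - (1 - a) * x)

theorem affAct_distrib (n : ℕ) (a : (ZMod n)ˣ) (x y z : ZMod n) :
    affAct n a x (affAct n a y z) = affAct n a (affAct n a x y) (affAct n a x z) := by
  simp only [affAct]; ring

theorem affAct_self (n : ℕ) (a : (ZMod n)ˣ) (x : ZMod n) : affAct n a x x = x := by
  simp only [affAct]; ring

instance (n : ℕ) (a : (ZMod n)ˣ) : Quandle (Aff n a) where
  act := affAct n a
  invAct := affInvAct n a
  self_distrib := affAct_distrib n a _ _ _
  left_inv x := (show Function.LeftInverse (affInvAct n a x) (affAct n a x) from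
    fun y => by simp [affAct, affInvAct])
  right_inv x := (show Function.RightInverse (affInvAct n a x) (affAct n a x) from
    fun y => by simp [affAct, affInvAct])
  fix := affAct_self n a _

/-- The one-point quandle `{1}`. -/
instance : Quandle Unit where
  act _ _ := ()
  invAct _ _ := ()
  self_distrib := rfl
  left_inv _ _ := rfl
  right_inv _ _ := rfl
  fix := rfl

/-! ### Yetter-Drinfeld modules over a group -/

open Classical in
/-- A Yetter-Drinfeld module structure over the group `G` on the `K`-vector space `V`:
a linear action of `G` and a decomposition `V = ⨁ V_g` with `h V_g ⊆ V_{h g h⁻¹}`. -/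
structure YetterDrinfeld (K G V : Type*) [Field K] [Group G] [AddCommGroup V] [Module K V] where
  /-- the action of `G` -/
  ρ : Representation K G V
  /-- the homogeneous components `V_g` -/
  comp : G → Submodule K V
  isInternal : DirectSum.IsInternal comp
  map_mem : ∀ (h g : G) (v : V), v ∈ comp g → ρ h v ∈ comp (h * g * h⁻¹)

namespace YetterDrinfeld

section Basic

variable {K G V W : Type*} [Field K] [Group G] [AddCommGroup V] [Module K V]
  [AddCommGroup W] [Module K W]

theorem comp_conj_ne_bot (M : YetterDrinfeld K G V) (h g : G) (hg : M.comp g ≠ ⊥) :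
    M.comp (h * g * h⁻¹) ≠ ⊥ := by
  obtain ⟨v, hv, hv0⟩ := Submodule.exists_mem_ne_zero_of_ne_bot hg
  intro hb
  have h1 := M.map_mem h g v hv
  rw [hb, Submodule.mem_bot] at h1
  apply hv0
  have h2 : M.ρ h⁻¹ (M.ρ h v) = v := by simp
  rw [← h2, h1, map_zero]

/-- The support `supp V = {g ∈ G | V_g ≠ 0}`, a quandle under conjugation. -/
def Supp (M : YetterDrinfeld K G V) : Type _ := {g : G | M.comp g ≠ ⊥}

instance (M : YetterDrinfeld K G V) : Quandle M.Supp :=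
  conjQuandle {g : G | M.comp g ≠ ⊥} fun h g hg => M.comp_conj_ne_bot h g hg

/-- The direct sum `V ⊕ W` of Yetter-Drinfeld modules. -/
noncomputable def prod (M : YetterDrinfeld K G V) (N : YetterDrinfeld K G W) : YetterDrinfeld K G (V × W) where
  ρ := M.ρ.prod N.ρ
  comp g := (M.comp g).prod (N.comp g)
  isInternal := by
    classical
    obtain ⟨hM1, hM2⟩ :=
      (DirectSum.isInternal_submodule_iff_iSupIndep_and_iSup_eq_top _).1 M.isInternal
    obtain ⟨hN1, hN2⟩ :=
      (DirectSum.isInternal_submodule_iff_iSupIndep_and_iSup_eq_top _).1 N.isInternal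
    refine (DirectSum.isInternal_submodule_iff_iSupIndep_and_iSup_eq_top _).2 ⟨?_, ?_⟩
    · intro g
      have hle : (⨆ j, ⨆ (_ : j ≠ g), (M.comp j).prod (N.comp j)) ≤
          (⨆ j, ⨆ (_ : j ≠ g), M.comp j).prod (⨆ j, ⨆ (_ : j ≠ g), N.comp j) :=
        iSup₂_le fun j hj => Submodule.prod_mono (le_iSup₂ (f := fun j _ => M.comp j) j hj)
          (le_iSup₂ (f := fun j _ => N.comp j) j hj)
      rw [Submodule.disjoint_def]
      rintro ⟨v, w⟩ ⟨hv, hw⟩ h2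
      obtain ⟨hv', hw'⟩ := hle h2
      exact Prod.ext ((Submodule.disjoint_def.1 (hM1 g)) v hv hv')
        ((Submodule.disjoint_def.1 (hN1 g)) w hw hw')
    · rw [eq_top_iff]
      rintro ⟨v, w⟩ -
      have h1 : (⨆ g, M.comp g).map (LinearMap.inl K V W) ≤
          ⨆ g, (M.comp g).prod (N.comp g) := by
        rw [Submodule.map_iSup]
        refine iSup_mono fun g => ?_
        rintro _ ⟨x, hx, rfl⟩
        exact ⟨hx, zero_mem _⟩
      have h2 : (⨆ g, N.comp g).map (LinearMap.inr K V W) ≤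
          ⨆ g, (M.comp g).prod (N.comp g) := by
        rw [Submodule.map_iSup]
        refine iSup_mono fun g => ?_
        rintro _ ⟨x, hx, rfl⟩
        exact ⟨zero_mem _, hx⟩
      have h3 := add_mem (h1 ⟨v, by simp [hM2], rfl⟩) (h2 ⟨w, by simp [hN2], rfl⟩)
      simpa using h3
  map_mem h g v hv := ⟨M.map_mem h g _ hv.1, N.map_mem h g _ hv.2⟩

open Classical in
theorem coeLinearMap_bijective (M : YetterDrinfeld K G V) :
    Function.Bijective (DirectSum.coeLinearMap M.comp) :=
  M.isInternal

open Classical in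
/-- The linear map on `V = ⨁ V_g` which is given by `F g` on `V_g`. -/
noncomputable def glue {X : Type*} [AddCommMonoid X] [Module K X] (M : YetterDrinfeld K G V)
    (F : G → V →ₗ[K] X) : V →ₗ[K] X :=
  DirectSum.toModule K G X (fun g => F g ∘ₗ (M.comp g).subtype) ∘ₗ
    (LinearEquiv.ofBijective (DirectSum.coeLinearMap M.comp) M.coeLinearMap_bijective).symm.toLinearMap

theorem glue_apply {X : Type*} [AddCommMonoid X] [Module K X] (M : YetterDrinfeld K G V)
    (F : G → V →ₗ[K] X) {g : G} {v : V} (hv : v ∈ M.comp g) : M.glue F v = F g v := by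
  classical
  have h : (LinearEquiv.ofBijective (DirectSum.coeLinearMap M.comp) M.coeLinearMap_bijective).symm v =
      DirectSum.lof K G (fun g => M.comp g) g ⟨v, hv⟩ := by
    rw [LinearEquiv.symm_apply_eq]
    simp
  simp [glue, h]

theorem span_homogeneous (M : YetterDrinfeld K G V) {p : Submodule K V}
    (hp : ∀ g, ∀ v ∈ M.comp g, v ∈ p) (v : V) : v ∈ p := by
  classical
  have h := ((DirectSum.isInternal_submodule_iff_iSupIndep_and_iSup_eq_top _).1 M.isInternal).2
  have h2 : (⨆ g, M.comp g) ≤ p := iSup_le fun g => hp g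
  rw [h] at h2
  exact h2 trivial

end Basic

/-! ### The Nichols algebra of a Yetter-Drinfeld module -/

section Nichols

variable {K G U : Type*} [Field K] [Group G] [AddCommGroup U] [Module K U]

/-- The diagonal action of `G` on the tensor algebra `T(U)`. -/
noncomputable def tensorAct (M : YetterDrinfeld K G U) (g : G) :
    TensorAlgebra K U →ₐ[K] TensorAlgebra K U :=
  TensorAlgebra.lift K (TensorAlgebra.ι K ∘ₗ M.ρ g)

/-- Auxiliary map for the recursive definition of `insertion`. -/
noncomputable def insertionStep (M : YetterDrinfeld K G U) (g : G) :
    U →ₗ[K] Module.End K (TensorAlgebra K U × (U →ₗ[K] TensorAlgebra K U)) where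
  toFun y :=
    { toFun := fun p =>
        (TensorAlgebra.ι K y * p.1,
          LinearMap.mulRight K (TensorAlgebra.ι K y * p.1) ∘ₗ TensorAlgebra.ι K +
            LinearMap.mulLeft K (TensorAlgebra.ι K (M.ρ g y)) ∘ₗ p.2)
      map_add' := by
        intro p q
        refine Prod.ext (by simp [mul_add]) (LinearMap.ext fun u => ?_)
        simp [mul_add, mul_assoc]; abel
      map_smul' := by
        intro c p
        refine Prod.ext (by simp) (LinearMap.ext fun u => ?_)
        simp [mul_assoc] }
  map_add' a b := by
    refine LinearMap.ext fun p => Prod.ext ?_ (LinearMap.ext fun u => ?_)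
    · simp [add_mul]
    · simp [add_mul, mul_add, mul_assoc]; abel
  map_smul' c a := by
    refine LinearMap.ext fun p => Prod.ext ?_ (LinearMap.ext fun u => ?_)
    · simp
    · simp [mul_assoc]

theorem insertionStep_apply (M : YetterDrinfeld K G U) (g : G) (y : U)
    (p : TensorAlgebra K U × (U →ₗ[K] TensorAlgebra K U)) :
    M.insertionStep g y p = (TensorAlgebra.ι K y * p.1,
      LinearMap.mulRight K (TensorAlgebra.ι K y * p.1) ∘ₗ TensorAlgebra.ι K +
        LinearMap.mulLeft K (TensorAlgebra.ι K (M.ρ g y)) ∘ₗ p.2) := rfl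

/-- For `u ∈ U_g` and `x = x₁ ⊗ ⋯ ⊗ xₙ`, the element
`insertion g x u = ∑ₖ (g x₁) ⊗ ⋯ ⊗ (g xₖ) ⊗ u ⊗ xₖ₊₁ ⊗ ⋯ ⊗ xₙ` of `T(U)`, that is, the image of
`u ⊗ x` under `id + c₁ + c₂ c₁ + ⋯ + cₙ ⋯ c₁`, where `cᵢ` denotes the braiding
`c(u ⊗ y) = g y ⊗ u` (`u ∈ U_g`) applied at the positions `i, i + 1`.
See `insertion_one` and `insertion_ι_mul` for the defining recursion. -/
noncomputable def insertion (M : YetterDrinfeld K G U) (g : G) (x : TensorAlgebra K U) :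
    U →ₗ[K] TensorAlgebra K U :=
  (TensorAlgebra.lift K (M.insertionStep g) x (1, TensorAlgebra.ι K)).2

theorem insertion_one (M : YetterDrinfeld K G U) (g : G) (u : U) :
    M.insertion g 1 u = TensorAlgebra.ι K u := by
  simp [insertion]

theorem insertion_fst (M : YetterDrinfeld K G U) (g : G) (x : TensorAlgebra K U) :
    ∀ p, (TensorAlgebra.lift K (M.insertionStep g) x p).1 = x * p.1 := by
  induction x using TensorAlgebra.induction with
  | algebraMap r => intro p; simp [Algebra.smul_def]
  | ι y => intro p; simp [insertionStep_apply]
  | mul a b ha hb => intro p; simp [ha, hb, mul_assoc]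
  | add a b ha hb => intro p; simp [ha, hb, add_mul]

theorem insertion_ι_mul (M : YetterDrinfeld K G U) (g : G) (u y : U) (x : TensorAlgebra K U) :
    M.insertion g (TensorAlgebra.ι K y * x) u =
      TensorAlgebra.ι K u * TensorAlgebra.ι K y * x +
        TensorAlgebra.ι K (M.ρ g y) * M.insertion g x u := by
  have h := M.insertion_fst g x (1, TensorAlgebra.ι K)
  rw [mul_one] at h
  simp only [insertion, map_mul, TensorAlgebra.lift_ι_apply, Module.End.mul_apply]
  simp [insertionStep_apply, h, mul_assoc]

theorem insertion_add (M : YetterDrinfeld K G U) (g : G) (u : U) (x y : TensorAlgebra K U) :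
    M.insertion g (x + y) u = M.insertion g x u + M.insertion g y u := by
  simp only [insertion, map_add, LinearMap.add_apply, Prod.snd_add]

theorem insertion_smul (M : YetterDrinfeld K G U) (g : G) (u : U) (c : K)
    (x : TensorAlgebra K U) : M.insertion g (c • x) u = c • M.insertion g x u := by
  simp only [insertion, map_smul, LinearMap.smul_apply, Prod.smul_snd]

/-- The operator `x ↦ insertion g x u` of `T(U)` for `u ∈ U_g`, extended linearly to all
`u ∈ U`; on `U^{⊗n}` it is `x ↦ (id + c₁ + c₂ c₁ + ⋯ + cₙ ⋯ c₁)(u ⊗ x)`. -/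
noncomputable def shuffleMul (M : YetterDrinfeld K G U) :
    U →ₗ[K] Module.End K (TensorAlgebra K U) :=
  M.glue fun g =>
    { toFun := fun u =>
        { toFun := fun x => M.insertion g x u
          map_add' := M.insertion_add g u
          map_smul' := M.insertion_smul g u }
      map_add' := fun u v => LinearMap.ext fun x => map_add (M.insertion g x) u v
      map_smul' := fun c u => LinearMap.ext fun x => map_smul (M.insertion g x) c u }

theorem shuffleMul_apply (M : YetterDrinfeld K G U) {g : G} {u : U} (hu : u ∈ M.comp g)
    (x : TensorAlgebra K U) : M.shuffleMul u x = M.insertion g x u := by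
  rw [shuffleMul, M.glue_apply _ hu]; rfl

/-- The quantum symmetrizer `⨁ Sₙ` on `T(U) = ⨁ U^{⊗n}`: by `quantumSymm_one` and
`quantumSymm_ι_mul`, `S₀ = id` and
`Sₙ₊₁ = (id + c₁ + c₂ c₁ + ⋯ + cₙ ⋯ c₁)(id ⊗ Sₙ)`. -/
noncomputable def quantumSymm (M : YetterDrinfeld K G U) :
    TensorAlgebra K U →ₗ[K] TensorAlgebra K U :=
  LinearMap.applyₗ (1 : TensorAlgebra K U) ∘ₗ (TensorAlgebra.lift K M.shuffleMul).toLinearMap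

theorem quantumSymm_one (M : YetterDrinfeld K G U) : M.quantumSymm 1 = 1 := by
  simp [quantumSymm]

theorem quantumSymm_mul (M : YetterDrinfeld K G U) (x y : TensorAlgebra K U) :
    M.quantumSymm (x * y) = TensorAlgebra.lift K M.shuffleMul x (M.quantumSymm y) := by
  simp [quantumSymm]

theorem quantumSymm_ι_mul (M : YetterDrinfeld K G U) (u : U) (x : TensorAlgebra K U) :
    M.quantumSymm (TensorAlgebra.ι K u * x) = M.shuffleMul u (M.quantumSymm x) := by
  simp [quantumSymm_mul]

theorem left_induction {p : Submodule K (TensorAlgebra K U)} (h1 : 1 ∈ p)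
    (h2 : ∀ y : U, ∀ x ∈ p, TensorAlgebra.ι K y * x ∈ p) (x : TensorAlgebra K U) : x ∈ p := by
  suffices h : ∀ a ∈ p, x * a ∈ p by simpa using h 1 h1
  induction x using TensorAlgebra.induction with
  | algebraMap r => intro a ha; rw [← Algebra.smul_def]; exact p.smul_mem r ha
  | ι y => exact h2 y
  | mul a b ha hb => intro c hc; rw [mul_assoc]; exact ha _ (hb _ hc)
  | add a b ha hb => intro c hc; rw [add_mul]; exact add_mem (ha _ hc) (hb _ hc)

theorem tensorAct_ι (M : YetterDrinfeld K G U) (g : G) (u : U) :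
    M.tensorAct g (TensorAlgebra.ι K u) = TensorAlgebra.ι K (M.ρ g u) := by
  simp [tensorAct]

theorem tensorAct_insertion (M : YetterDrinfeld K G U) (h g : G) (u : U)
    (x : TensorAlgebra K U) :
    M.tensorAct h (M.insertion g x u) =
      M.insertion (h * g * h⁻¹) (M.tensorAct h x) (M.ρ h u) := by
  let L (g : G) (u : U) : TensorAlgebra K U →ₗ[K] TensorAlgebra K U :=
    { toFun := fun x => M.insertion g x u
      map_add' := M.insertion_add g u
      map_smul' := M.insertion_smul g u }
  have hL : ∀ g u x, L g u x = M.insertion g x u := fun _ _ _ => rfl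
  refine left_induction (p := LinearMap.eqLocus ((M.tensorAct h).toLinearMap ∘ₗ L g u)
    (L (h * g * h⁻¹) (M.ρ h u) ∘ₗ (M.tensorAct h).toLinearMap)) ?_ ?_ x
  · simp [hL, insertion_one, tensorAct_ι, LinearMap.mem_eqLocus]
  · intro y x hx
    simp only [LinearMap.mem_eqLocus, LinearMap.comp_apply, AlgHom.toLinearMap_apply,
      hL] at hx ⊢
    rw [insertion_ι_mul, map_mul, tensorAct_ι, insertion_ι_mul, map_add, map_mul, map_mul,
      map_mul, hx]
    simp [tensorAct_ι]

theorem tensorAct_quantumSymm (M : YetterDrinfeld K G U) (h : G) (x : TensorAlgebra K U) :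
    M.tensorAct h (M.quantumSymm x) = M.quantumSymm (M.tensorAct h x) := by
  refine left_induction (p := LinearMap.eqLocus ((M.tensorAct h).toLinearMap ∘ₗ M.quantumSymm)
    (M.quantumSymm ∘ₗ (M.tensorAct h).toLinearMap)) ?_ ?_ x
  · simp [quantumSymm_one, LinearMap.mem_eqLocus]
  · intro y x hx
    simp only [LinearMap.mem_eqLocus, LinearMap.comp_apply, AlgHom.toLinearMap_apply] at hx ⊢
    rw [quantumSymm_ι_mul, map_mul, tensorAct_ι, quantumSymm_ι_mul, ← hx]
    generalize M.quantumSymm x = z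
    refine M.span_homogeneous (p := LinearMap.eqLocus
      ((M.tensorAct h).toLinearMap ∘ₗ M.shuffleMul.flip z)
      (M.shuffleMul.flip (M.tensorAct h z) ∘ₗ M.ρ h)) ?_ y
    intro g u hu
    simp only [LinearMap.mem_eqLocus, LinearMap.comp_apply, AlgHom.toLinearMap_apply,
      LinearMap.flip_apply]
    rw [M.shuffleMul_apply hu, M.shuffleMul_apply (M.map_mem h g u hu), tensorAct_insertion]

/-- Auxiliary map for `exists_rightInsertion`. -/
noncomputable def rightStepAux (M : YetterDrinfeld K G U) (h : G) :
    U →ₗ[K] Module.End K (TensorAlgebra K U × (U →ₗ[K] TensorAlgebra K U)) :=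
  { toFun := fun y =>
      { toFun := fun p =>
          (p.1 * TensorAlgebra.ι K y,
            LinearMap.mulLeft K (p.1 * TensorAlgebra.ι K y) ∘ₗ TensorAlgebra.ι K +
              LinearMap.mulRight K (TensorAlgebra.ι K y) ∘ₗ p.2 ∘ₗ M.ρ h)
        map_add' := by
          intro p q
          refine Prod.ext (by simp [add_mul]) (LinearMap.ext fun u => ?_)
          simp [add_mul, mul_assoc]; abel
        map_smul' := by
          intro c p
          refine Prod.ext (by simp) (LinearMap.ext fun u => ?_)
          simp [mul_assoc] }
    map_add' := by
      intro a b
      refine LinearMap.ext fun p => Prod.ext ?_ (LinearMap.ext fun u => ?_)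
      · simp [mul_add]
      · simp [add_mul, mul_add, mul_assoc]; abel
    map_smul' := by
      intro c a
      refine LinearMap.ext fun p => Prod.ext ?_ (LinearMap.ext fun u => ?_)
      · simp
      · simp [mul_assoc] }

/-- Auxiliary map for `exists_rightInsertion`. -/
noncomputable def rightStep (M : YetterDrinfeld K G U) :
    U →ₗ[K] Module.End K (TensorAlgebra K U × (U →ₗ[K] TensorAlgebra K U)) :=
  M.glue M.rightStepAux

theorem rightStep_apply (M : YetterDrinfeld K G U) {h : G} {y : U} (hy : y ∈ M.comp h)
    (p : TensorAlgebra K U × (U →ₗ[K] TensorAlgebra K U)) :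
    M.rightStep y p = (p.1 * TensorAlgebra.ι K y,
      LinearMap.mulLeft K (p.1 * TensorAlgebra.ι K y) ∘ₗ TensorAlgebra.ι K +
        LinearMap.mulRight K (TensorAlgebra.ι K y) ∘ₗ p.2 ∘ₗ M.ρ h) := by
  rw [rightStep, M.glue_apply M.rightStepAux hy]
  rfl

theorem exists_rightInsertion (M : YetterDrinfeld K G U) :
    ∃ R : TensorAlgebra K U →ₗ[K] U →ₗ[K] TensorAlgebra K U,
      (∀ v, R 1 v = TensorAlgebra.ι K v) ∧
      ∀ h, ∀ y ∈ M.comp h, ∀ x v, R (x * TensorAlgebra.ι K y) v =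
        x * TensorAlgebra.ι K y * TensorAlgebra.ι K v +
          R x (M.ρ h v) * TensorAlgebra.ι K y := by
  let F := TensorAlgebra.lift K
    ((MulOpposite.opLinearEquiv K).toLinearMap ∘ₗ M.rightStep)
  have hF : ∀ x y p, (F (x * TensorAlgebra.ι K y)).unop p = M.rightStep y ((F x).unop p) := by
    intro x y p
    simp [F]
  have hF1 : ∀ x, ∀ p, ((F x).unop p).1 = p.1 * x := by
    have hs : ∀ y p, (M.rightStep y p).1 = p.1 * TensorAlgebra.ι K y := by
      intro y p
      refine M.span_homogeneous (p := LinearMap.eqLocus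
        (LinearMap.fst K (TensorAlgebra K U) (U →ₗ[K] TensorAlgebra K U) ∘ₗ M.rightStep.flip p)
        (LinearMap.mulLeft K p.1 ∘ₗ TensorAlgebra.ι K)) ?_ y
      intro g u hu
      simp only [LinearMap.mem_eqLocus, LinearMap.comp_apply, LinearMap.flip_apply]
      rw [M.rightStep_apply hu]
      rfl
    intro x
    induction x using TensorAlgebra.induction with
    | algebraMap r =>
      intro p
      simp [MulOpposite.algebraMap_apply, ← Algebra.commutes, Algebra.smul_def]
    | ι y => intro p; simp [F, hs]
    | mul a b ha hb => intro p; simp [ha, hb, mul_assoc]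
    | add a b ha hb => intro p; simp [ha, hb, mul_add]
  refine ⟨{ toFun := fun x => ((F x).unop (1, TensorAlgebra.ι K)).2
            map_add' := by intro x y; simp
            map_smul' := by intro c x; simp }, ?_, ?_⟩
  · intro v; simp
  · intro h y hy x v
    have h1 := hF1 x (1, TensorAlgebra.ι K)
    rw [one_mul] at h1
    simp only [LinearMap.coe_mk, AddHom.coe_mk]
    rw [hF, M.rightStep_apply hy]
    simp [h1, mul_assoc]

/-- The product of a list of homogeneous elements of `U`. -/
noncomputable def mono (M : YetterDrinfeld K G U) (l : List (Σ g, M.comp g)) :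
    TensorAlgebra K U :=
  (l.map fun p => TensorAlgebra.ι K (p.2 : U)).prod

/-- The homogeneous component of degree `d ∈ G` of `T(U)`. -/
noncomputable def tensorComp (M : YetterDrinfeld K G U) (d : G) :
    Submodule K (TensorAlgebra K U) :=
  Submodule.span K {x | ∃ l, (l.map Sigma.fst).prod = d ∧ M.mono l = x}

theorem ι_mul_mem_tensorComp (M : YetterDrinfeld K G U) {g d : G} {u : U} (hu : u ∈ M.comp g)
    {x : TensorAlgebra K U} (hx : x ∈ M.tensorComp d) :
    TensorAlgebra.ι K u * x ∈ M.tensorComp (g * d) := by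
  have h : M.tensorComp d ≤ (M.tensorComp (g * d)).comap
      (LinearMap.mulLeft K (TensorAlgebra.ι K u)) := by
    refine Submodule.span_le.2 ?_
    rintro _ ⟨l, rfl, rfl⟩
    exact Submodule.subset_span ⟨(⟨g, ⟨u, hu⟩⟩ : Σ g, M.comp g) :: l, by simp, by simp [mono]⟩
  exact h hx

theorem insertion_mem_tensorComp (M : YetterDrinfeld K G U) {g : G} {u : U} (hu : u ∈ M.comp g)
    (l : List (Σ g, M.comp g)) :
    M.insertion g (M.mono l) u ∈ M.tensorComp (g * (l.map Sigma.fst).prod) := by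
  induction l with
  | nil => exact Submodule.subset_span ⟨[⟨g, u, hu⟩], by simp, by simp [mono, insertion_one]⟩
  | cons y l ih =>
    have h : M.mono (y :: l) = TensorAlgebra.ι K (y.2 : U) * M.mono l := by simp [mono]
    have hl : M.mono l ∈ M.tensorComp (l.map Sigma.fst).prod :=
      Submodule.subset_span ⟨l, rfl, rfl⟩
    rw [h, insertion_ι_mul, mul_assoc]
    refine add_mem ?_ ?_
    · simpa using M.ι_mul_mem_tensorComp hu (M.ι_mul_mem_tensorComp y.2.2 hl)
    · simpa [mul_assoc] using M.ι_mul_mem_tensorComp (M.map_mem g _ _ y.2.2) ih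

theorem homogeneous_induction (M : YetterDrinfeld K G U) {p : Submodule K (TensorAlgebra K U)}
    (h : ∀ l, M.mono l ∈ p) (x : TensorAlgebra K U) : x ∈ p := by
  have hs : Submodule.span K (Set.range M.mono) ≤ p :=
    Submodule.span_le.2 (by rintro _ ⟨l, rfl⟩; exact h l)
  have h1 : (1 : TensorAlgebra K U) ∈ Submodule.span K (Set.range M.mono) :=
    Submodule.subset_span ⟨[], by simp [mono]⟩
  refine hs (left_induction h1 ?_ x)
  intro y x hx
  refine M.span_homogeneous (p := (Submodule.span K (Set.range M.mono)).comap
    (LinearMap.mulRight K x ∘ₗ TensorAlgebra.ι K)) ?_ y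
  intro g u hu
  have h2 : Submodule.span K (Set.range M.mono) ≤ (Submodule.span K (Set.range M.mono)).comap
      (LinearMap.mulLeft K (TensorAlgebra.ι K u)) := by
    refine Submodule.span_le.2 ?_
    rintro _ ⟨l, rfl⟩
    exact Submodule.subset_span ⟨(⟨g, ⟨u, hu⟩⟩ : Σ g, M.comp g) :: l, by simp [mono]⟩
  exact h2 hx

/-- The kernel of the quantum symmetrizer is stable under right multiplication by `U`. -/
theorem quantumSymm_mul_ι (M : YetterDrinfeld K G U) (a : TensorAlgebra K U) (v : U)
    (ha : M.quantumSymm a = 0) : M.quantumSymm (a * TensorAlgebra.ι K v) = 0 := by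
  obtain ⟨R, hR1, hR2⟩ := M.exists_rightInsertion
  have hR3 : ∀ (l : List (Σ g, M.comp g)) (h : G), ∀ y ∈ M.comp h, ∀ v,
      R (TensorAlgebra.ι K y * M.mono l) v = TensorAlgebra.ι K y * R (M.mono l) v +
        TensorAlgebra.ι K (M.ρ (h * (l.map Sigma.fst).prod) v) *
          (TensorAlgebra.ι K y * M.mono l) := by
    intro l h y hy
    induction l using List.reverseRecOn with
    | nil =>
      intro v
      have := hR2 h y hy 1 v
      simpa [mono, hR1] using this
    | append_singleton l w ih =>
      intro v
      have hl : M.mono (l ++ [w]) = M.mono l * TensorAlgebra.ι K (w.2 : U) := by simp [mono]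
      rw [hl, ← mul_assoc, hR2 w.1 _ w.2.2, hR2 w.1 _ w.2.2, ih]
      simp [mul_add, add_mul, mul_assoc]
      abel
  have hR4 : ∀ (d : G), ∀ z ∈ M.tensorComp d, ∀ (h : G), ∀ y ∈ M.comp h, ∀ v,
      R (TensorAlgebra.ι K y * z) v = TensorAlgebra.ι K y * R z v +
        TensorAlgebra.ι K (M.ρ (h * d) v) * (TensorAlgebra.ι K y * z) := by
    intro d z hz h y hy v
    have hle : M.tensorComp d ≤ LinearMap.eqLocus
        (R.flip v ∘ₗ LinearMap.mulLeft K (TensorAlgebra.ι K y))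
        (LinearMap.mulLeft K (TensorAlgebra.ι K y) ∘ₗ R.flip v +
          LinearMap.mulLeft K (TensorAlgebra.ι K (M.ρ (h * d) v)) ∘ₗ
            LinearMap.mulLeft K (TensorAlgebra.ι K y)) := by
      refine Submodule.span_le.2 ?_
      rintro _ ⟨l, rfl, rfl⟩
      exact hR3 l h y hy v
    exact hle hz
  have hcomm : ∀ g, ∀ u ∈ M.comp g, ∀ (l : List (Σ g, M.comp g)) v,
      M.insertion g (R (M.mono l) v) u = R (M.insertion g (M.mono l) u) v := by
    intro g u hu l v
    induction l with
    | nil =>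
      have h1 := hR2 g u hu 1 v
      have h2 := M.insertion_ι_mul g u v 1
      simp only [one_mul, mul_one, insertion_one, hR1] at h1 h2
      simp [mono, insertion_one, hR1, h1, h2]
    | cons y l ih =>
      have h : M.mono (y :: l) = TensorAlgebra.ι K (y.2 : U) * M.mono l := by simp [mono]
      have hl : M.mono l ∈ M.tensorComp (l.map Sigma.fst).prod :=
        Submodule.subset_span ⟨l, rfl, rfl⟩
      have hyl := M.ι_mul_mem_tensorComp y.2.2 hl
      rw [h, hR3 l _ _ y.2.2, insertion_add, insertion_ι_mul, insertion_ι_mul, insertion_ι_mul,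
        ih, map_add, LinearMap.add_apply, mul_assoc (TensorAlgebra.ι K u) (TensorAlgebra.ι K (y.2 : U)) (M.mono l),
        hR4 _ _ hyl _ _ hu,
        hR3 l _ _ y.2.2, hR4 _ _ (M.insertion_mem_tensorComp hu l) _ _ (M.map_mem g _ _ y.2.2)]
      simp [mul_add, mul_assoc]
      abel
  have hcomm' : ∀ u z v, M.shuffleMul u (R z v) = R (M.shuffleMul u z) v := by
    intro u z v
    refine M.span_homogeneous (p := LinearMap.eqLocus (M.shuffleMul.flip (R z v))
      (R.flip v ∘ₗ M.shuffleMul.flip z)) ?_ u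
    intro g u hu
    refine M.homogeneous_induction (p := LinearMap.eqLocus (M.shuffleMul u ∘ₗ R.flip v)
      (R.flip v ∘ₗ M.shuffleMul u)) ?_ z
    intro l
    simp only [LinearMap.mem_eqLocus, LinearMap.comp_apply, LinearMap.flip_apply]
    rw [M.shuffleMul_apply hu, M.shuffleMul_apply hu, hcomm g u hu]
  have hone : ∀ v, M.shuffleMul v 1 = TensorAlgebra.ι K v := by
    intro v
    refine M.span_homogeneous (p := LinearMap.eqLocus (M.shuffleMul.flip 1)
      (TensorAlgebra.ι K)) ?_ v
    intro g u hu
    simp only [LinearMap.mem_eqLocus, LinearMap.flip_apply]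
    rw [M.shuffleMul_apply hu, insertion_one]
  have key : M.quantumSymm (a * TensorAlgebra.ι K v) = R (M.quantumSymm a) v := by
    refine left_induction (p := LinearMap.eqLocus
      (M.quantumSymm ∘ₗ LinearMap.mulRight K (TensorAlgebra.ι K v))
      (R.flip v ∘ₗ M.quantumSymm)) ?_ ?_ a
    · have := M.quantumSymm_ι_mul v 1
      simp only [mul_one, quantumSymm_one, hone] at this
      simp [LinearMap.mem_eqLocus, quantumSymm_one, hR1, this]
    · intro y x hx
      simp only [LinearMap.mem_eqLocus, LinearMap.comp_apply, LinearMap.flip_apply,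
        LinearMap.mulRight_apply] at hx ⊢
      rw [mul_assoc, quantumSymm_ι_mul, quantumSymm_ι_mul, hx, hcomm']
  rw [key, ha, map_zero, LinearMap.zero_apply]

/-- The ideal `⨁ ker Sₙ` of `T(U)`. -/
noncomputable def nicholsIdeal (M : YetterDrinfeld K G U) : Ideal (TensorAlgebra K U) where
  carrier := {x | M.quantumSymm x = 0}
  add_mem' := by
    intro a b ha hb
    simp only [Set.mem_ofPred_eq] at ha hb ⊢
    rw [map_add, ha, hb, add_zero]
  zero_mem' := map_zero _
  smul_mem' := by
    intro c x hx
    simp only [Set.mem_ofPred_eq] at hx ⊢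
    rw [smul_eq_mul, quantumSymm_mul, hx, map_zero]

theorem mem_nicholsIdeal (M : YetterDrinfeld K G U) (x : TensorAlgebra K U) :
    x ∈ M.nicholsIdeal ↔ M.quantumSymm x = 0 := Iff.rfl

instance (M : YetterDrinfeld K G U) : M.nicholsIdeal.IsTwoSided where
  mul_mem_of_left := by
    intro a b ha
    induction b using TensorAlgebra.induction generalizing a with
    | algebraMap r =>
      rw [← Algebra.commutes]
      exact M.nicholsIdeal.mul_mem_left _ ha
    | ι v => exact M.quantumSymm_mul_ι a v ha
    | mul b c hb hc => rw [← mul_assoc]; exact hc (hb ha)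
    | add b c hb hc => rw [mul_add]; exact add_mem (hb ha) (hc ha)

/-- The Nichols algebra `B(U) = T(U) / ⨁ ker Sₙ`. -/
abbrev NicholsAlgebra (M : YetterDrinfeld K G U) : Type _ :=
  TensorAlgebra K U ⧸ M.nicholsIdeal

/-- The canonical map `U → B(U)`. -/
noncomputable def nicholsι (M : YetterDrinfeld K G U) : U →ₗ[K] M.NicholsAlgebra :=
  (Ideal.Quotient.mkₐ K M.nicholsIdeal).toLinearMap ∘ₗ TensorAlgebra.ι K

/-- The action of `G` on `B(U)` by algebra maps. -/
noncomputable def nicholsAct (M : YetterDrinfeld K G U) (g : G) :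
    M.NicholsAlgebra →ₐ[K] M.NicholsAlgebra :=
  Ideal.Quotient.liftₐ M.nicholsIdeal
    ((Ideal.Quotient.mkₐ K M.nicholsIdeal).comp (M.tensorAct g)) (by
      intro a ha
      rw [AlgHom.comp_apply, Ideal.Quotient.mkₐ_eq_mk, Ideal.Quotient.eq_zero_iff_mem,
        mem_nicholsIdeal, ← tensorAct_quantumSymm, (M.mem_nicholsIdeal a).1 ha, map_zero])

/-- The braided adjoint action of `U` on `B(U)`: `(ad u)(y) = u y - (g · y) u` for `u ∈ U_g` and
`y ∈ B(U)`. -/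
noncomputable def ad (M : YetterDrinfeld K G U) :
    U →ₗ[K] M.NicholsAlgebra →ₗ[K] M.NicholsAlgebra :=
  M.glue fun g =>
    { toFun := fun u => LinearMap.mulLeft K (M.nicholsι u) -
        LinearMap.mulRight K (M.nicholsι u) ∘ₗ (M.nicholsAct g).toLinearMap
      map_add' := by
        intro a b
        refine LinearMap.ext fun y => ?_
        simp [add_mul, mul_add]; abel
      map_smul' := by
        intro c a
        refine LinearMap.ext fun y => ?_
        simp [smul_sub] }

end Nichols

section AdPow

variable {K G V W : Type*} [Field K] [Group G] [AddCommGroup V] [Module K V]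
  [AddCommGroup W] [Module K W]

/-- The subspace `(ad V)^n(W)` of `B(V ⊕ W)`: `(ad V)^0(W) = W`, and `(ad V)^{n+1}(W)` is spanned
by the elements `(ad v)(y)` with `v ∈ V` and `y ∈ (ad V)^n(W)`. -/
noncomputable def adPow (M : YetterDrinfeld K G V) (N : YetterDrinfeld K G W) :
    ℕ → Submodule K (M.prod N).NicholsAlgebra
  | 0 => (LinearMap.range (LinearMap.inr K V W)).map (M.prod N).nicholsι
  | n + 1 => Submodule.map₂ (M.prod N).ad (LinearMap.range (LinearMap.inl K V W)) (adPow M N n)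

end AdPow

end YetterDrinfeld

/-! The proof splits into a bound and a finite search: the support has at most six elements, and the
indecomposable quandles of that size can be enumerated.

For the bound one computes in `T(V ⊕ W)` modulo the Nichols ideal. Every linear form `ξ` gives a
skew derivation `D_ξ` preserving this ideal. For `v ∈ V_p` let `A_v(a) = v (p⁻¹ · a) - a v`, which
is the adjoint action up to the automorphism `p⁻¹`. If `a` has degree `h`, then `D_ξ (A_v a) = ξ(v)
p⁻¹ · a - ξ(h v) a + A_v (D_ξ a)` (`deriv_twistedAd`, `leftDeriv_leftAd`). When `h p h⁻¹ ≠ p`, a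
form living on only one of the degrees `p` and `h p h⁻¹` isolates one of the two leading terms. So
`a` can be recovered from `A_v a`, and whatever annihilates `A_v a` also annihilates `a`, up to
conjugation by `p`.

The predicate `IsRigid` packages what is transported in this way: a nonzero element together with a
set `F` of degrees such that any `t` in the support, `t ∉ F`, with `V_t` acting trivially commutes
with the degree and with all of `F`. The lemmas `IsRigid.step`, `IsRigid.step_entering` and
`IsRigid.step_fixed` build rigid elements one level higher, with `F` enlarged by few elements. In
`(ad V)³(W)` every `V_t` acts trivially, so the part of the support outside `F` commutes with `F`;
by indecomposability the support then lies in `F` (`support_subset_of_commute`). Keeping track of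
`F` up to level three gives `card_supp_le_six`.

For the search, the points are relabelled so that one left translation is a standard permutation of
its cycle type (`exists_transport_eq`). A backtracking search over the remaining rows, evaluated by
the kernel, leaves only tables of the listed quandles. -/

namespace YetterDrinfeld

/-! ### Skew derivations of the tensor algebra and the Nichols ideal. -/

section Derivation

variable {K G U : Type*} [Field K] [Group G] [AddCommGroup U] [Module K U]

/-- Auxiliary map for the definition of `contract`. -/
noncomputable def contractStep (ξ : U →ₗ[K] K) :
    U →ₗ[K] Module.End K (TensorAlgebra K U × TensorAlgebra K U) where
  toFun y :=
    { toFun := fun p => (TensorAlgebra.ι K y * p.1, ξ y • p.1)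
      map_add' := by intro p q; simp [mul_add]
      map_smul' := by intro c p; simp [smul_smul, mul_comm] }
  map_add' a b := by
    refine LinearMap.ext fun p => Prod.ext ?_ ?_
    · simp [add_mul]
    · simp [add_smul]
  map_smul' c a := by
    refine LinearMap.ext fun p => Prod.ext ?_ ?_
    · simp
    · simp [mul_smul]

/-- The contraction of the first tensor factor with the linear form `ξ`. -/
noncomputable def contract (ξ : U →ₗ[K] K) : TensorAlgebra K U →ₗ[K] TensorAlgebra K U where
  toFun x := (TensorAlgebra.lift K (contractStep ξ) x (1, 0)).2
  map_add' x y := by simp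
  map_smul' c x := by simp

theorem contract_one (ξ : U →ₗ[K] K) : contract ξ 1 = 0 := by
  simp [contract]

theorem contract_ι_mul (ξ : U →ₗ[K] K) (y : U) (x : TensorAlgebra K U) :
    contract ξ (TensorAlgebra.ι K y * x) = ξ y • x := by
  -- The first component only accumulates the product; it supplies the tail left behind when `ξ`
  -- consumes the first letter.
  have h : ∀ p, (TensorAlgebra.lift K (contractStep ξ) x p).1 = x * p.1 := by
    induction x using TensorAlgebra.induction with
    | algebraMap r => intro p; simp [Algebra.smul_def]
    | ι y => intro p; simp [contractStep]
    | mul a b ha hb => intro p; simp [ha, hb, mul_assoc]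
    | add a b ha hb => intro p; simp [ha, hb, add_mul]
  have h1 := h (1, 0)
  rw [mul_one] at h1
  simp only [contract, LinearMap.coe_mk, AddHom.coe_mk, map_mul, TensorAlgebra.lift_ι_apply,
    Module.End.mul_apply]
  nth_rw 2 [← h1]
  rfl

/-- Auxiliary map for the definition of `derivStep`. -/
noncomputable def derivStepAux (M : YetterDrinfeld K G U) (g : G) :
    U →ₗ[K] Module.End K (TensorAlgebra K U × ((U →ₗ[K] K) →ₗ[K] TensorAlgebra K U)) where
  toFun y :=
    { toFun := fun p =>
        (TensorAlgebra.ι K y * p.1,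
          (LinearMap.applyₗ y).smulRight p.1 +
            LinearMap.mulLeft K (TensorAlgebra.ι K y) ∘ₗ p.2 ∘ₗ LinearMap.lcomp K K (M.ρ g))
      map_add' := by
        intro p q
        refine Prod.ext (by simp [mul_add]) (LinearMap.ext fun ξ => ?_)
        simp [mul_add]; abel
      map_smul' := by
        intro c p
        refine Prod.ext (by simp) (LinearMap.ext fun ξ => ?_)
        simp [smul_smul, mul_comm] }
  map_add' a b := by
    refine LinearMap.ext fun p => Prod.ext ?_ (LinearMap.ext fun ξ => ?_)
    · simp [add_mul]
    · simp [add_mul, add_smul]; abel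
  map_smul' c a := by
    refine LinearMap.ext fun p => Prod.ext ?_ (LinearMap.ext fun ξ => ?_)
    · simp
    · simp [mul_smul]

/-- Auxiliary map for the definition of `deriv`. -/
noncomputable def derivStep (M : YetterDrinfeld K G U) :
    U →ₗ[K] Module.End K (TensorAlgebra K U × ((U →ₗ[K] K) →ₗ[K] TensorAlgebra K U)) :=
  M.glue M.derivStepAux

theorem derivStep_apply (M : YetterDrinfeld K G U) {g : G} {y : U} (hy : y ∈ M.comp g)
    (p : TensorAlgebra K U × ((U →ₗ[K] K) →ₗ[K] TensorAlgebra K U)) :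
    M.derivStep y p = (TensorAlgebra.ι K y * p.1,
      (LinearMap.applyₗ y).smulRight p.1 +
        LinearMap.mulLeft K (TensorAlgebra.ι K y) ∘ₗ p.2 ∘ₗ LinearMap.lcomp K K (M.ρ g)) := by
  rw [derivStep, M.glue_apply M.derivStepAux hy]
  rfl

/-- The skew derivation of `T(U)` attached to a linear form `ξ` on `U`, which is determined by
`deriv_one` and `deriv_ι_mul`. -/
noncomputable def deriv (M : YetterDrinfeld K G U) :
    TensorAlgebra K U →ₗ[K] (U →ₗ[K] K) →ₗ[K] TensorAlgebra K U where
  toFun x := (TensorAlgebra.lift K M.derivStep x (1, 0)).2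
  map_add' x y := by simp
  map_smul' c x := by simp

theorem deriv_one (M : YetterDrinfeld K G U) (ξ : U →ₗ[K] K) : M.deriv 1 ξ = 0 := by
  simp [deriv]

theorem deriv_ι_mul (M : YetterDrinfeld K G U) {g : G} {y : U} (hy : y ∈ M.comp g)
    (x : TensorAlgebra K U) (ξ : U →ₗ[K] K) :
    M.deriv (TensorAlgebra.ι K y * x) ξ =
      ξ y • x + TensorAlgebra.ι K y * M.deriv x (ξ ∘ₗ M.ρ g) := by
  have hs : ∀ y p, (M.derivStep y p).1 = TensorAlgebra.ι K y * p.1 := by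
    intro y p
    refine M.span_homogeneous (p := LinearMap.eqLocus
      (LinearMap.fst K (TensorAlgebra K U) ((U →ₗ[K] K) →ₗ[K] TensorAlgebra K U) ∘ₗ
        M.derivStep.flip p)
      (LinearMap.mulRight K p.1 ∘ₗ TensorAlgebra.ι K)) ?_ y
    intro g u hu
    simp only [LinearMap.mem_eqLocus, LinearMap.comp_apply, LinearMap.flip_apply]
    rw [M.derivStep_apply hu]
    rfl
  have h : ∀ p, (TensorAlgebra.lift K M.derivStep x p).1 = x * p.1 := by
    induction x using TensorAlgebra.induction with
    | algebraMap r => intro p; simp [Algebra.smul_def]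
    | ι y => intro p; simp [hs]
    | mul a b ha hb => intro p; simp [ha, hb, mul_assoc]
    | add a b ha hb => intro p; simp [ha, hb, add_mul]
  have h1 := h (1, 0)
  rw [mul_one] at h1
  simp only [deriv, LinearMap.coe_mk, AddHom.coe_mk, map_mul, TensorAlgebra.lift_ι_apply,
    Module.End.mul_apply]
  rw [M.derivStep_apply hy]
  simp only [h1, LinearMap.add_apply, LinearMap.smulRight_apply, LinearMap.applyₗ_apply_apply]
  rfl

theorem deriv_ι (M : YetterDrinfeld K G U) (y : U) (ξ : U →ₗ[K] K) :
    M.deriv (TensorAlgebra.ι K y) ξ = algebraMap K _ (ξ y) := by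
  refine M.span_homogeneous (p := LinearMap.eqLocus (M.deriv.flip ξ ∘ₗ TensorAlgebra.ι K)
    (Algebra.linearMap K (TensorAlgebra K U) ∘ₗ ξ)) ?_ y
  intro g u hu
  have := M.deriv_ι_mul hu 1 ξ
  rw [mul_one, deriv_one, mul_zero, add_zero] at this
  simp [LinearMap.mem_eqLocus, this, Algebra.smul_def]

theorem mono_cons (M : YetterDrinfeld K G U) (y : Σ g, M.comp g) (l : List (Σ g, M.comp g)) :
    M.mono (y :: l) = TensorAlgebra.ι K (y.2 : U) * M.mono l := by
  simp [mono]

theorem mono_mem_tensorComp (M : YetterDrinfeld K G U) (l : List (Σ g, M.comp g)) :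
    M.mono l ∈ M.tensorComp (l.map Sigma.fst).prod :=
  Submodule.subset_span ⟨l, rfl, rfl⟩

theorem ι_mem_tensorComp (M : YetterDrinfeld K G U) {g : G} {u : U} (hu : u ∈ M.comp g) :
    TensorAlgebra.ι K u ∈ M.tensorComp g := by
  have := M.mono_mem_tensorComp [⟨g, u, hu⟩]
  simpa [mono] using this

theorem mul_mem_tensorComp (M : YetterDrinfeld K G U) {c d : G} {a b : TensorAlgebra K U}
    (ha : a ∈ M.tensorComp c) (hb : b ∈ M.tensorComp d) : a * b ∈ M.tensorComp (c * d) := by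
  have h1 : M.tensorComp c ≤ (M.tensorComp (c * d)).comap (LinearMap.mulRight K b) := by
    refine Submodule.span_le.2 ?_
    rintro _ ⟨l, rfl, rfl⟩
    have h2 : M.tensorComp d ≤ (M.tensorComp ((l.map Sigma.fst).prod * d)).comap
        (LinearMap.mulLeft K (M.mono l)) := by
      refine Submodule.span_le.2 ?_
      rintro _ ⟨l', rfl, rfl⟩
      exact Submodule.subset_span ⟨l ++ l', by simp, by simp [mono]⟩
    exact h2 hb
  exact h1 ha

theorem tensorAct_mem_tensorComp (M : YetterDrinfeld K G U) (g : G) {d : G}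
    {a : TensorAlgebra K U} (ha : a ∈ M.tensorComp d) :
    M.tensorAct g a ∈ M.tensorComp (g * d * g⁻¹) := by
  have h : M.tensorComp d ≤ (M.tensorComp (g * d * g⁻¹)).comap (M.tensorAct g).toLinearMap := by
    refine Submodule.span_le.2 ?_
    rintro _ ⟨l, rfl, rfl⟩
    clear ha
    induction l with
    | nil =>
      have := M.mono_mem_tensorComp []
      simpa [mono] using this
    | cons y l ih =>
      have := M.mul_mem_tensorComp (M.ι_mem_tensorComp (M.map_mem g _ _ y.2.2)) ih
      simpa [mono, tensorAct_ι, mul_assoc] using this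
  exact h ha

theorem tensorAct_mul (M : YetterDrinfeld K G U) (g h : G) (a : TensorAlgebra K U) :
    M.tensorAct (g * h) a = M.tensorAct g (M.tensorAct h a) := by
  have : M.tensorAct (g * h) = (M.tensorAct g).comp (M.tensorAct h) := by
    apply TensorAlgebra.hom_ext
    refine LinearMap.ext fun u => ?_
    simp [tensorAct_ι]
  rw [this, AlgHom.comp_apply]

theorem tensorAct_one (M : YetterDrinfeld K G U) (a : TensorAlgebra K U) :
    M.tensorAct 1 a = a := by
  have : M.tensorAct 1 = AlgHom.id K _ := by
    apply TensorAlgebra.hom_ext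
    refine LinearMap.ext fun u => ?_
    simp [tensorAct_ι]
  rw [this, AlgHom.id_apply]

/-- Moving the derivation past a homogeneous factor composes the form with the action of each letter
in turn, hence with the action of the total degree. -/
theorem deriv_mul (M : YetterDrinfeld K G U) {d : G} {a : TensorAlgebra K U}
    (ha : a ∈ M.tensorComp d) (b : TensorAlgebra K U) (ξ : U →ₗ[K] K) :
    M.deriv (a * b) ξ = M.deriv a ξ * b + a * M.deriv b (ξ ∘ₗ M.ρ d) := by
  have h : M.tensorComp d ≤ LinearMap.eqLocus (M.deriv.flip ξ ∘ₗ LinearMap.mulRight K b)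
      (LinearMap.mulRight K b ∘ₗ M.deriv.flip ξ +
        LinearMap.mulRight K (M.deriv b (ξ ∘ₗ M.ρ d))) := by
    refine Submodule.span_le.2 ?_
    rintro _ ⟨l, rfl, rfl⟩
    clear ha
    simp only [SetLike.mem_coe, LinearMap.mem_eqLocus, LinearMap.comp_apply,
      LinearMap.flip_apply, LinearMap.mulRight_apply, LinearMap.add_apply]
    induction l generalizing ξ with
    | nil => simp [mono, deriv_one]; rfl
    | cons y l ih =>
      rw [mono_cons, mul_assoc, M.deriv_ι_mul y.2.2, M.deriv_ι_mul y.2.2, ih]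
      have : (ξ ∘ₗ M.ρ y.1) ∘ₗ M.ρ (l.map Sigma.fst).prod =
          ξ ∘ₗ M.ρ ((y :: l).map Sigma.fst).prod := by
        refine LinearMap.ext fun u => ?_
        simp
      rw [this]
      simp [add_mul, mul_add, mul_assoc, add_assoc]
  exact h ha

theorem deriv_tensorAct (M : YetterDrinfeld K G U) (g : G) (a : TensorAlgebra K U)
    (ξ : U →ₗ[K] K) :
    M.deriv (M.tensorAct g a) ξ = M.tensorAct g (M.deriv a (ξ ∘ₗ M.ρ g)) := by
  refine M.homogeneous_induction (p := LinearMap.eqLocus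
    (M.deriv.flip ξ ∘ₗ (M.tensorAct g).toLinearMap)
    ((M.tensorAct g).toLinearMap ∘ₗ M.deriv.flip (ξ ∘ₗ M.ρ g))) ?_ a
  intro l
  simp only [LinearMap.mem_eqLocus, LinearMap.comp_apply, LinearMap.flip_apply,
    AlgHom.toLinearMap_apply]
  induction l generalizing ξ with
  | nil => simp [mono, deriv_one]
  | cons y l ih =>
    rw [mono_cons, map_mul, tensorAct_ι, M.deriv_ι_mul (M.map_mem g _ _ y.2.2), ih,
      M.deriv_ι_mul y.2.2]
    have : (ξ ∘ₗ M.ρ (g * y.1 * g⁻¹)) ∘ₗ M.ρ g = (ξ ∘ₗ M.ρ g) ∘ₗ M.ρ y.1 := by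
      refine LinearMap.ext fun u => ?_
      simp
    rw [this]
    simp [tensorAct_ι]

/-- After the insertion the leftmost letter is either `u` itself or `g x₁`; in the second case `ξ`
sees `x₁` through `ρ g`. -/
theorem contract_insertion (M : YetterDrinfeld K G U) (g : G) (u : U) (x : TensorAlgebra K U)
    (ξ : U →ₗ[K] K) :
    contract ξ (M.insertion g x u) =
      ξ u • x + M.insertion g (contract (ξ ∘ₗ M.ρ g) x) u := by
  let L : TensorAlgebra K U →ₗ[K] TensorAlgebra K U :=
    { toFun := fun x => M.insertion g x u
      map_add' := M.insertion_add g u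
      map_smul' := M.insertion_smul g u }
  have hL : ∀ x, L x = M.insertion g x u := fun _ => rfl
  refine left_induction (p := LinearMap.eqLocus (contract ξ ∘ₗ L)
    (ξ u • LinearMap.id + L ∘ₗ contract (ξ ∘ₗ M.ρ g))) ?_ ?_ x
  · have := contract_ι_mul ξ u 1
    rw [mul_one] at this
    simp [LinearMap.mem_eqLocus, hL, insertion_one, contract_one, this]
    rw [← hL, map_zero]
  · intro y x _
    simp only [LinearMap.mem_eqLocus, LinearMap.comp_apply, LinearMap.add_apply,
      LinearMap.smul_apply, LinearMap.id_apply, hL]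
    rw [insertion_ι_mul, map_add, mul_assoc, contract_ι_mul, contract_ι_mul, contract_ι_mul,
      insertion_smul]
    rfl

/-- Contraction after symmetrizing obeys the recursion that defines the skew derivation. This is why
derivations preserve the kernel of the symmetrizer. -/
theorem contract_quantumSymm (M : YetterDrinfeld K G U) (a : TensorAlgebra K U)
    (ξ : U →ₗ[K] K) : contract ξ (M.quantumSymm a) = M.quantumSymm (M.deriv a ξ) := by
  refine M.homogeneous_induction (p := LinearMap.eqLocus (contract ξ ∘ₗ M.quantumSymm)
    (M.quantumSymm ∘ₗ M.deriv.flip ξ)) ?_ a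
  intro l
  simp only [LinearMap.mem_eqLocus, LinearMap.comp_apply, LinearMap.flip_apply]
  induction l generalizing ξ with
  | nil => simp [mono, deriv_one, quantumSymm_one, contract_one]
  | cons y l ih =>
    rw [mono_cons, quantumSymm_ι_mul, M.shuffleMul_apply y.2.2, contract_insertion, ih,
      M.deriv_ι_mul y.2.2, map_add, map_smul, quantumSymm_ι_mul, M.shuffleMul_apply y.2.2]

theorem deriv_mem_nicholsIdeal (M : YetterDrinfeld K G U) {a : TensorAlgebra K U}
    (ha : a ∈ M.nicholsIdeal) (ξ : U →ₗ[K] K) : M.deriv a ξ ∈ M.nicholsIdeal := by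
  rw [mem_nicholsIdeal] at ha ⊢
  rw [← contract_quantumSymm, ha, map_zero]

theorem tensorAct_mem_nicholsIdeal (M : YetterDrinfeld K G U) (g : G) {a : TensorAlgebra K U}
    (ha : a ∈ M.nicholsIdeal) : M.tensorAct g a ∈ M.nicholsIdeal := by
  rw [mem_nicholsIdeal] at ha ⊢
  rw [← tensorAct_quantumSymm, ha, map_zero]

theorem tensorAct_mem_nicholsIdeal_iff (M : YetterDrinfeld K G U) (g : G)
    {a : TensorAlgebra K U} : M.tensorAct g a ∈ M.nicholsIdeal ↔ a ∈ M.nicholsIdeal := by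
  refine ⟨fun h => ?_, M.tensorAct_mem_nicholsIdeal g⟩
  have := M.tensorAct_mem_nicholsIdeal g⁻¹ h
  rwa [← tensorAct_mul, inv_mul_cancel, tensorAct_one] at this

/-- The operator `a ↦ u (p⁻¹ · a) - a u` of `T(U)`; for `u ∈ U_p` it induces the operator
`y ↦ (ad u)(p⁻¹ · y)` of the Nichols algebra. -/
noncomputable def twistedAd (M : YetterDrinfeld K G U) (p : G) (u : U) :
    TensorAlgebra K U →ₗ[K] TensorAlgebra K U :=
  LinearMap.mulLeft K (TensorAlgebra.ι K u) ∘ₗ (M.tensorAct p⁻¹).toLinearMap -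
    LinearMap.mulRight K (TensorAlgebra.ι K u)

theorem twistedAd_apply (M : YetterDrinfeld K G U) (p : G) (u : U) (a : TensorAlgebra K U) :
    M.twistedAd p u a =
      TensorAlgebra.ι K u * M.tensorAct p⁻¹ a - a * TensorAlgebra.ι K u := rfl

theorem twistedAd_mem_nicholsIdeal (M : YetterDrinfeld K G U) (p : G) (u : U)
    {a : TensorAlgebra K U} (ha : a ∈ M.nicholsIdeal) :
    M.twistedAd p u a ∈ M.nicholsIdeal :=
  sub_mem (M.nicholsIdeal.mul_mem_left _ (M.tensorAct_mem_nicholsIdeal _ ha))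
    (M.nicholsIdeal.mul_mem_right _ ha)

theorem twistedAd_mem_tensorComp (M : YetterDrinfeld K G U) {p h : G} {u : U}
    (hu : u ∈ M.comp p) {a : TensorAlgebra K U} (ha : a ∈ M.tensorComp h) :
    M.twistedAd p u a ∈ M.tensorComp (h * p) := by
  refine sub_mem ?_ (M.mul_mem_tensorComp ha (M.ι_mem_tensorComp hu))
  have := M.mul_mem_tensorComp (M.ι_mem_tensorComp hu) (M.tensorAct_mem_tensorComp p⁻¹ ha)
  simpa [mul_assoc] using this

theorem tensorAct_twistedAd (M : YetterDrinfeld K G U) (g p : G) (u : U)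
    (a : TensorAlgebra K U) :
    M.tensorAct g (M.twistedAd p u a) =
      M.twistedAd (g * p * g⁻¹) (M.ρ g u) (M.tensorAct g a) := by
  simp only [twistedAd_apply, map_sub, map_mul, tensorAct_ι, ← tensorAct_mul]
  congr 3
  simp [mul_assoc]

/-- The twist by `p⁻¹` is made for this formula: the letter `u` changes `ξ` to `ξ ∘ ρ p`, and the
twist undoes it. So the same `ξ` appears on both sides, and the two operators commute up to two
explicit terms. -/
theorem deriv_twistedAd (M : YetterDrinfeld K G U) {p h : G} {u : U} (hu : u ∈ M.comp p)
    {a : TensorAlgebra K U} (ha : a ∈ M.tensorComp h) (ξ : U →ₗ[K] K) :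
    M.deriv (M.twistedAd p u a) ξ =
      ξ u • M.tensorAct p⁻¹ a - ξ (M.ρ h u) • a + M.twistedAd p u (M.deriv a ξ) := by
  have h1 : (ξ ∘ₗ M.ρ p) ∘ₗ M.ρ p⁻¹ = ξ := by
    refine LinearMap.ext fun v => ?_
    simp
  rw [twistedAd_apply, map_sub, LinearMap.sub_apply, M.deriv_ι_mul hu, M.deriv_tensorAct, h1,
    M.deriv_mul ha, deriv_ι, twistedAd_apply]
  simp only [LinearMap.comp_apply, ← Algebra.commutes, ← Algebra.smul_def]
  abel

theorem exists_dual (M : YetterDrinfeld K G U) {q : G} {u : U} (hu : u ∈ M.comp q)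
    (h0 : u ≠ 0) : ∃ ξ : U →ₗ[K] K, ξ u = 1 ∧ ∀ g, g ≠ q → ∀ v ∈ M.comp g, ξ v = 0 := by
  classical
  obtain ⟨φ, hφ⟩ := Module.Projective.exists_dual_eq_one K h0
  refine ⟨M.glue fun g => if g = q then φ else 0, ?_, ?_⟩
  · rw [M.glue_apply _ hu, if_pos rfl, hφ]
  · intro g hg v hv
    rw [M.glue_apply _ hv, if_neg hg, LinearMap.zero_apply]

end Derivation

end YetterDrinfeld

namespace YetterDrinfeld

/-! ### Rigid elements and how the adjoint action propagates them. -/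

section Rigid

variable {K G V W : Type*} [Field K] [Group G] [AddCommGroup V] [Module K V]
  [AddCommGroup W] [Module K W]

theorem commute_iff_conj_eq {h t : G} : Commute t h ↔ h * t * h⁻¹ = t := by
  rw [mul_inv_eq_iff_eq_mul]
  exact ⟨fun e => e.symm, fun e => e.symm⟩

/-- The skew derivation of `T(V ⊕ W)` attached to a linear form on `V`, extended by zero. -/
noncomputable def leftDeriv (M : YetterDrinfeld K G V) (N : YetterDrinfeld K G W)
    (ξ : V →ₗ[K] K) : TensorAlgebra K (V × W) →ₗ[K] TensorAlgebra K (V × W) :=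
  (M.prod N).deriv.flip (ξ ∘ₗ LinearMap.fst K V W)

/-- The operator `twistedAd` of `T(V ⊕ W)` for elements of `V`. -/
noncomputable def leftAd (M : YetterDrinfeld K G V) (N : YetterDrinfeld K G W)
    (p : G) (v : V) : TensorAlgebra K (V × W) →ₗ[K] TensorAlgebra K (V × W) :=
  (M.prod N).twistedAd p (v, 0)

theorem mem_comp_prod_inl (M : YetterDrinfeld K G V) (N : YetterDrinfeld K G W) {p : G} {v : V}
    (hv : v ∈ M.comp p) : (v, (0 : W)) ∈ (M.prod N).comp p :=
  ⟨hv, zero_mem _⟩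

theorem mem_comp_prod_inr (M : YetterDrinfeld K G V) (N : YetterDrinfeld K G W) {s : G} {w : W}
    (hw : w ∈ N.comp s) : ((0 : V), w) ∈ (M.prod N).comp s :=
  ⟨zero_mem _, hw⟩

theorem prod_ρ_apply (M : YetterDrinfeld K G V) (N : YetterDrinfeld K G W) (g : G) (v : V)
    (w : W) : (M.prod N).ρ g (v, w) = (M.ρ g v, N.ρ g w) := rfl

theorem leftDeriv_leftAd (M : YetterDrinfeld K G V) (N : YetterDrinfeld K G W) {p h : G} {v : V}
    (hv : v ∈ M.comp p) {a : TensorAlgebra K (V × W)} (ha : a ∈ (M.prod N).tensorComp h)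
    (ξ : V →ₗ[K] K) :
    M.leftDeriv N ξ (M.leftAd N p v a) = ξ v • (M.prod N).tensorAct p⁻¹ a -
      ξ (M.ρ h v) • a + M.leftAd N p v (M.leftDeriv N ξ a) :=
  (M.prod N).deriv_twistedAd (M.mem_comp_prod_inl N hv) ha _

theorem leftDeriv_mem (M : YetterDrinfeld K G V) (N : YetterDrinfeld K G W) (ξ : V →ₗ[K] K)
    {a : TensorAlgebra K (V × W)} (ha : a ∈ (M.prod N).nicholsIdeal) :
    M.leftDeriv N ξ a ∈ (M.prod N).nicholsIdeal :=
  (M.prod N).deriv_mem_nicholsIdeal ha _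

theorem leftAd_mem (M : YetterDrinfeld K G V) (N : YetterDrinfeld K G W) (p : G) (v : V)
    {a : TensorAlgebra K (V × W)} (ha : a ∈ (M.prod N).nicholsIdeal) :
    M.leftAd N p v a ∈ (M.prod N).nicholsIdeal :=
  (M.prod N).twistedAd_mem_nicholsIdeal p _ ha

/-- The elements of `F` are the only ones which may occur in the leftmost tensor factor of the
quantum symmetrization of `a`. -/
def LeftSupported (M : YetterDrinfeld K G V) (N : YetterDrinfeld K G W) (F : Set G)
    (a : TensorAlgebra K (V × W)) : Prop :=
  ∀ ξ : V →ₗ[K] K, (∀ f ∈ F, ∀ v ∈ M.comp f, ξ v = 0) →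
    M.leftDeriv N ξ a ∈ (M.prod N).nicholsIdeal

/-- The element `a` of the Nichols algebra is annihilated by the adjoint action of `V_t`. -/
def AdTrivial (M : YetterDrinfeld K G V) (N : YetterDrinfeld K G W) (t : G)
    (a : TensorAlgebra K (V × W)) : Prop :=
  ∀ v ∈ M.comp t, M.leftAd N t v a ∈ (M.prod N).nicholsIdeal

/-- A nonzero homogeneous element of degree `h` of the Nichols algebra with leftmost factors in
`F`, such that the adjoint action of `V_t` with `t ∉ F` can only be trivial on it if `t` commutes
with `h` and with `F`. -/
structure IsRigid (M : YetterDrinfeld K G V) (N : YetterDrinfeld K G W) (h : G) (F : Set G)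
    (a : TensorAlgebra K (V × W)) : Prop where
  mem : a ∈ (M.prod N).tensorComp h
  notMem : a ∉ (M.prod N).nicholsIdeal
  supported : M.LeftSupported N F a
  commute : ∀ t ∉ F, M.comp t ≠ ⊥ → M.AdTrivial N t a → Commute t h ∧ ∀ f ∈ F, Commute t f

/-- If `h t h⁻¹ ≠ t`, a form living on `V_t` only and dual to `w ∈ V_t` turns `leftAd w a` into `t⁻¹
· a` modulo the ideal: it kills `h w`, and `t ∉ F` removes the derivative of `a`. Triviality would
then put `a` in the ideal. -/
theorem commute_degree (M : YetterDrinfeld K G V) (N : YetterDrinfeld K G W) {h : G} {F : Set G}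
    {a : TensorAlgebra K (V × W)} (ha : a ∈ (M.prod N).tensorComp h)
    (ha0 : a ∉ (M.prod N).nicholsIdeal) (hF : M.LeftSupported N F a) {t : G} (htF : t ∉ F)
    (ht : M.comp t ≠ ⊥) (had : M.AdTrivial N t a) : Commute t h := by
  rw [commute_iff_conj_eq]
  by_contra hne
  obtain ⟨w, hw, hw0⟩ := Submodule.exists_mem_ne_zero_of_ne_bot ht
  obtain ⟨ξ, hξ1, hξ2⟩ := M.exists_dual hw hw0
  have h1 := M.leftDeriv_mem N ξ (had w hw)
  rw [M.leftDeriv_leftAd N hw ha, hξ1, hξ2 _ hne _ (M.map_mem h t w hw), one_smul, zero_smul,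
    sub_zero] at h1
  have h2 : M.leftAd N t w (M.leftDeriv N ξ a) ∈ (M.prod N).nicholsIdeal :=
    M.leftAd_mem N _ _ (hF ξ fun f hf v hv => hξ2 f (fun e => htF (e ▸ hf)) v hv)
  exact ha0 (((M.prod N).tensorAct_mem_nicholsIdeal_iff t⁻¹).1 ((add_mem_cancel_right h2).1 h1))

theorem LeftSupported.mono {M : YetterDrinfeld K G V} {N : YetterDrinfeld K G W} {F F' : Set G}
    {a : TensorAlgebra K (V × W)} (hF : M.LeftSupported N F a) (h : F ⊆ F') :
    M.LeftSupported N F' a :=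
  fun ξ hξ => hF ξ fun f hf => hξ f (h hf)

/-- The only new leftmost letters are `v` and `h v`, of degrees `p` and `h p h⁻¹`. -/
theorem LeftSupported.leftAd {M : YetterDrinfeld K G V} {N : YetterDrinfeld K G W} {h p : G}
    {F : Set G} {a : TensorAlgebra K (V × W)} (hF : M.LeftSupported N F a)
    (ha : a ∈ (M.prod N).tensorComp h) {v : V} (hv : v ∈ M.comp p) :
    M.LeftSupported N (F ∪ {p, h * p * h⁻¹}) (M.leftAd N p v a) := by
  intro ξ hξ
  rw [M.leftDeriv_leftAd N hv ha, hξ p (by simp) v hv,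
    hξ (h * p * h⁻¹) (by simp) _ (M.map_mem h p v hv), zero_smul, zero_smul, sub_zero, zero_add]
  exact M.leftAd_mem N _ _ (hF ξ fun f hf => hξ f (Or.inl hf))

/-- A form dual to `h v` rather than to `v` recovers `-a` itself, with no twist by `p⁻¹`. The price
is that `h p h⁻¹`, rather than `p`, has to avoid `F`. -/
theorem exists_leftDeriv_leftAd_add_mem (M : YetterDrinfeld K G V) (N : YetterDrinfeld K G W)
    {h p : G} {F : Set G} {a : TensorAlgebra K (V × W)} (ha : a ∈ (M.prod N).tensorComp h)
    (hF : M.LeftSupported N F a) {v : V} (hv : v ∈ M.comp p) (hv0 : v ≠ 0)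
    (hpF : h * p * h⁻¹ ∉ F) (hpp : h * p * h⁻¹ ≠ p) :
    ∃ ξ : V →ₗ[K] K, (∀ g, g ≠ h * p * h⁻¹ → ∀ u ∈ M.comp g, ξ u = 0) ∧
      M.leftDeriv N ξ (M.leftAd N p v a) + a ∈ (M.prod N).nicholsIdeal := by
  have h0 : M.ρ h v ≠ 0 := by
    intro e
    apply hv0
    have : M.ρ h⁻¹ (M.ρ h v) = v := by simp
    rw [← this, e, map_zero]
  obtain ⟨ξ, hξ1, hξ2⟩ := M.exists_dual (M.map_mem h p v hv) h0
  refine ⟨ξ, hξ2, ?_⟩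
  rw [M.leftDeriv_leftAd N hv ha, hξ1, hξ2 p hpp.symm v hv, zero_smul, zero_sub, one_smul,
    neg_add_eq_sub, sub_add_cancel]
  exact M.leftAd_mem N _ _ (hF ξ fun f hf u hu => hξ2 f (fun e => hpF (e ▸ hf)) u hu)

/-- If `ξ` vanishes on `V_t` and `t` commutes with the degree of `a`, then the adjoint action
of `V_t` on `a` commutes with the derivation of `ξ`. -/
theorem AdTrivial.leftDeriv {M : YetterDrinfeld K G V} {N : YetterDrinfeld K G W} {h t : G}
    {a : TensorAlgebra K (V × W)} (ha : a ∈ (M.prod N).tensorComp h) (had : M.AdTrivial N t a)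
    (hc : Commute t h) {ξ : V →ₗ[K] K} (hξ : ∀ u ∈ M.comp t, ξ u = 0) :
    M.AdTrivial N t (M.leftDeriv N ξ a) := by
  intro w hw
  have h1 := M.leftDeriv_mem N ξ (had w hw)
  have h2 := M.map_mem h t w hw
  rw [commute_iff_conj_eq.1 hc] at h2
  rwa [M.leftDeriv_leftAd N hw ha, hξ w hw, hξ _ h2, zero_smul, zero_smul, sub_zero,
    zero_add] at h1

theorem AdTrivial.congr_neg {M : YetterDrinfeld K G V} {N : YetterDrinfeld K G W} {t : G}
    {a b : TensorAlgebra K (V × W)} (had : M.AdTrivial N t a)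
    (hab : a + b ∈ (M.prod N).nicholsIdeal) : M.AdTrivial N t b := by
  intro w hw
  have h1 := M.leftAd_mem N t w hab
  rw [map_add] at h1
  exact (add_mem_cancel_left (had w hw)).1 h1

theorem AdTrivial.tensorAct {M : YetterDrinfeld K G V} {N : YetterDrinfeld K G W} {t : G}
    {a : TensorAlgebra K (V × W)} (had : M.AdTrivial N t a) (g : G) :
    M.AdTrivial N (g * t * g⁻¹) ((M.prod N).tensorAct g a) := by
  intro w hw
  have h1 := M.map_mem g⁻¹ _ w hw
  have e : g⁻¹ * (g * t * g⁻¹) * g⁻¹⁻¹ = t := by group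
  rw [e] at h1
  have h2 := (M.prod N).tensorAct_mem_nicholsIdeal g (had _ h1)
  rw [YetterDrinfeld.leftAd, tensorAct_twistedAd, prod_ρ_apply] at h2
  simpa [YetterDrinfeld.leftAd] using h2

/-- Differentiating back to `-a` shows that the new element is nonzero and that triviality of `V_t`
descends to `a`. Then `t` commutes with `h`, with `F` and with the new degree `h p`, hence with `p`
and `h p h⁻¹`. The element `p` itself may lie in `F`. -/
theorem IsRigid.step {M : YetterDrinfeld K G V} {N : YetterDrinfeld K G W} {h p : G} {F : Set G}
    {a : TensorAlgebra K (V × W)} (H : M.IsRigid N h F a) {v : V} (hv : v ∈ M.comp p)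
    (hv0 : v ≠ 0) (hpF : h * p * h⁻¹ ∉ F) (hpp : h * p * h⁻¹ ≠ p) :
    M.IsRigid N (h * p) (F ∪ {p, h * p * h⁻¹}) (M.leftAd N p v a) := by
  obtain ⟨ξ, hξ, hD⟩ := M.exists_leftDeriv_leftAd_add_mem N H.mem H.supported hv hv0 hpF hpp
  have hmem : M.leftAd N p v a ∈ (M.prod N).tensorComp (h * p) :=
    (M.prod N).twistedAd_mem_tensorComp (M.mem_comp_prod_inl N hv) H.mem
  have hsupp := H.supported.leftAd H.mem hv
  have hne : M.leftAd N p v a ∉ (M.prod N).nicholsIdeal := fun e =>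
    H.notMem ((add_mem_cancel_left (M.leftDeriv_mem N ξ e)).1 hD)
  refine ⟨hmem, hne, hsupp, fun t ht ht0 had => ?_⟩
  have hc := M.commute_degree N hmem hne hsupp ht ht0 had
  have had' := (had.leftDeriv hmem hc (hξ t (by rintro rfl; simp at ht))).congr_neg hD
  obtain ⟨h1, h2⟩ := H.commute t (fun e => ht (Or.inl e)) ht0 had'
  have h3 : Commute t p := by simpa using h1.inv_right.mul_right hc
  refine ⟨hc, ?_⟩
  rintro f (hf | rfl | rfl)
  · exact h2 f hf
  · exact h3
  · exact (h1.mul_right h3).mul_right h1.inv_right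

/-- This covers the case that `h` carries `p` into `F`. A form dual to `v` recovers `p⁻¹ · a`, so
triviality of `V_t` becomes triviality of `V_{p t p⁻¹}` on `a`. Rigidity of `a` applies only if `p t
p⁻¹ ∉ F`, which is why the preimage of `F` under conjugation by `p` joins the new set. -/
theorem IsRigid.step_entering {M : YetterDrinfeld K G V} {N : YetterDrinfeld K G W} {h p : G}
    {F : Set G} {a : TensorAlgebra K (V × W)} (H : M.IsRigid N h F a) {v : V}
    (hv : v ∈ M.comp p) (hv0 : v ≠ 0) (hpF : p ∉ F) (hpp : h * p * h⁻¹ ≠ p) :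
    M.IsRigid N (h * p) (F ∪ {p, h * p * h⁻¹} ∪ {x | p * x * p⁻¹ ∈ F}) (M.leftAd N p v a) := by
  obtain ⟨ξ, hξ1, hξ⟩ := M.exists_dual hv hv0
  have hD : M.leftDeriv N ξ (M.leftAd N p v a) - (M.prod N).tensorAct p⁻¹ a ∈
      (M.prod N).nicholsIdeal := by
    rw [M.leftDeriv_leftAd N hv H.mem, hξ1, hξ _ hpp _ (M.map_mem h p v hv), zero_smul, one_smul,
      sub_zero, add_sub_cancel_left]
    exact M.leftAd_mem N _ _
      (H.supported ξ fun f hf u hu => hξ f (fun e => hpF (e ▸ hf)) u hu)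
  have hmem : M.leftAd N p v a ∈ (M.prod N).tensorComp (h * p) :=
    (M.prod N).twistedAd_mem_tensorComp (M.mem_comp_prod_inl N hv) H.mem
  have hsupp := (H.supported.leftAd H.mem hv).mono
    (Set.subset_union_left (t := {x | p * x * p⁻¹ ∈ F}))
  have hne : M.leftAd N p v a ∉ (M.prod N).nicholsIdeal := fun e =>
    H.notMem (((M.prod N).tensorAct_mem_nicholsIdeal_iff p⁻¹).1
      (by simpa using sub_mem (M.leftDeriv_mem N ξ e) hD))
  refine ⟨hmem, hne, hsupp, fun t ht ht0 had => ?_⟩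
  have hc := M.commute_degree N hmem hne hsupp ht ht0 had
  have had1 := had.leftDeriv hmem hc (hξ t (by rintro rfl; simp at ht))
  have had2 : M.AdTrivial N t ((M.prod N).tensorAct p⁻¹ a) := by
    intro w hw
    have e := M.leftAd_mem N t w hD
    rw [map_sub] at e
    simpa using sub_mem (had1 w hw) e
  have had3 := had2.tensorAct p
  rw [← tensorAct_mul, mul_inv_cancel, tensorAct_one] at had3
  obtain ⟨h1, h2⟩ := H.commute (p * t * p⁻¹) (fun e => ht (Or.inr e))
    (M.comp_conj_ne_bot p t ht0) had3
  have hconj : ∀ {x : G}, Commute (p * t * p⁻¹) x → Commute t (p⁻¹ * x * p) := by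
    intro x hx
    have h5 := hx.map (MulAut.conj p⁻¹)
    simpa [mul_assoc] using h5
  have h3 : Commute t p := by
    have := hc.mul_right (hconj h1).inv_right
    simpa [mul_assoc] using this
  have h4 : Commute t h := by simpa using hc.mul_right h3.inv_right
  have hback : ∀ x, p * x * p⁻¹ ∈ F → Commute t x := by
    intro x hx
    simpa [mul_assoc] using hconj (h2 _ hx)
  have hpt : p * t * p⁻¹ = t := commute_iff_conj_eq.1 h3
  refine ⟨hc, ?_⟩
  rintro f ((hf | rfl | rfl) | hf)
  · have := h2 f hf
    rwa [hpt] at this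
  · exact h3
  · exact (h4.mul_right h3).mul_right h4.inv_right
  · exact hback f hf

/-- A single step with `t` is impossible here, since `t` commutes with the degree `h p`. But a form
on the degree `h p h⁻¹` that kills `V_t` passes through the outer operator and removes the inner
one. The result is `-leftAd t w a`, so rigidity is borrowed from that shorter element. -/
theorem IsRigid.step_fixed {M : YetterDrinfeld K G V} {N : YetterDrinfeld K G W} {h p t : G}
    {F F' : Set G} {a : TensorAlgebra K (V × W)} (ha : a ∈ (M.prod N).tensorComp h)
    (hF : M.LeftSupported N F a) {v w : V} (hv : v ∈ M.comp p) (hv0 : v ≠ 0)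
    (hpF : h * p * h⁻¹ ∉ F) (hpp : h * p * h⁻¹ ≠ p) (hw : w ∈ M.comp t)
    (htp : h * p * h⁻¹ ≠ t) (hc : Commute t (h * p))
    (H : M.IsRigid N (h * t) F' (M.leftAd N t w a)) (hFF' : F ⊆ F') (htF' : t ∈ F') :
    M.IsRigid N (h * p * t) (F ∪ {p, h * p * h⁻¹} ∪ F')
      (M.leftAd N t w (M.leftAd N p v a)) := by
  obtain ⟨ξ, hξ, hD⟩ := M.exists_leftDeriv_leftAd_add_mem N ha hF hv hv0 hpF hpp
  have hmem1 : M.leftAd N p v a ∈ (M.prod N).tensorComp (h * p) :=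
    (M.prod N).twistedAd_mem_tensorComp (M.mem_comp_prod_inl N hv) ha
  have hmem := (M.prod N).twistedAd_mem_tensorComp (M.mem_comp_prod_inl N hw) hmem1
  have hsupp : M.LeftSupported N (F ∪ {p, h * p * h⁻¹} ∪ F')
      (M.leftAd N t w (M.leftAd N p v a)) := by
    refine ((hF.leftAd ha hv).leftAd hmem1 hw).mono ?_
    rw [commute_iff_conj_eq.1 hc]
    refine Set.union_subset Set.subset_union_left ?_
    rintro x (rfl | rfl)
    · exact Or.inr htF'
    · exact Or.inr htF'
  have hwt := M.map_mem (h * p) t w hw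
  rw [commute_iff_conj_eq.1 hc] at hwt
  have hD2 : M.leftDeriv N ξ (M.leftAd N t w (M.leftAd N p v a)) + M.leftAd N t w a ∈
      (M.prod N).nicholsIdeal := by
    rw [M.leftDeriv_leftAd N hw hmem1, hξ t htp.symm w hw, hξ t htp.symm _ hwt, zero_smul,
      zero_smul, sub_zero, zero_add, ← map_add]
    exact M.leftAd_mem N _ _ hD
  have hne : M.leftAd N t w (M.leftAd N p v a) ∉ (M.prod N).nicholsIdeal := fun e =>
    H.notMem ((add_mem_cancel_left (M.leftDeriv_mem N ξ e)).1 hD2)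
  refine ⟨hmem, hne, hsupp, fun u hu hu0 had => ?_⟩
  have hcu := M.commute_degree N hmem hne hsupp hu hu0 had
  have had' := (had.leftDeriv hmem hcu (hξ u (by rintro rfl; simp at hu))).congr_neg hD2
  obtain ⟨h1, h2⟩ := H.commute u (fun e => hu (Or.inr e)) hu0 had'
  have h3 := h2 t htF'
  have h4 : Commute u h := by simpa using h1.mul_right h3.inv_right
  have h5 : Commute u p := by
    simpa [mul_assoc] using h4.inv_right.mul_right (hcu.mul_right h3.inv_right)
  refine ⟨hcu, ?_⟩
  rintro f ((hf | rfl | rfl) | hf)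
  · exact h2 f (hFF' hf)
  · exact h5
  · exact (h4.mul_right h5).mul_right h4.inv_right
  · exact h2 f hf

/-- The starting point: derivations along `V` kill `W`, so no letter of `V` can occur in front. -/
theorem isRigid_ι (M : YetterDrinfeld K G V) (N : YetterDrinfeld K G W) {s : G} {w : W}
    (hw : w ∈ N.comp s)
    (hne : TensorAlgebra.ι K ((0 : V), w) ∉ (M.prod N).nicholsIdeal) :
    M.IsRigid N s ∅ (TensorAlgebra.ι K ((0 : V), w)) := by
  have hmem := (M.prod N).ι_mem_tensorComp (M.mem_comp_prod_inr N hw)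
  have hsupp : M.LeftSupported N ∅ (TensorAlgebra.ι K ((0 : V), w)) := by
    intro ξ _
    have := (M.prod N).deriv_ι ((0 : V), w) (ξ ∘ₗ LinearMap.fst K V W)
    simp only [LinearMap.comp_apply, LinearMap.fst_apply, map_zero] at this
    rw [leftDeriv, LinearMap.flip_apply, this]
    exact zero_mem _
  exact ⟨hmem, hne, hsupp, fun t ht ht0 had =>
    ⟨M.commute_degree N hmem hne hsupp ht ht0 had, by simp⟩⟩

theorem quantumSymm_ι {U : Type*} [AddCommGroup U] [Module K U] (M : YetterDrinfeld K G U)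
    (u : U) : M.quantumSymm (TensorAlgebra.ι K u) = TensorAlgebra.ι K u := by
  refine M.span_homogeneous (p := LinearMap.eqLocus (M.quantumSymm ∘ₗ TensorAlgebra.ι K)
    (TensorAlgebra.ι K)) ?_ u
  intro g v hv
  have := M.quantumSymm_ι_mul v 1
  rw [mul_one, quantumSymm_one, M.shuffleMul_apply hv, insertion_one] at this
  simpa [LinearMap.mem_eqLocus] using this

theorem ι_notMem_nicholsIdeal {U : Type*} [AddCommGroup U] [Module K U]
    (M : YetterDrinfeld K G U) {u : U} (hu : u ≠ 0) :
    TensorAlgebra.ι K u ∉ M.nicholsIdeal := by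
  rw [mem_nicholsIdeal, quantumSymm_ι]
  simpa using hu

theorem nicholsAct_mk {U : Type*} [AddCommGroup U] [Module K U] (M : YetterDrinfeld K G U)
    (g : G) (a : TensorAlgebra K U) :
    M.nicholsAct g (Ideal.Quotient.mk M.nicholsIdeal a) =
      Ideal.Quotient.mk M.nicholsIdeal (M.tensorAct g a) := rfl

theorem ad_mk {U : Type*} [AddCommGroup U] [Module K U] (M : YetterDrinfeld K G U) {g : G}
    {u : U} (hu : u ∈ M.comp g) (a : TensorAlgebra K U) :
    M.ad u (Ideal.Quotient.mk M.nicholsIdeal a) = Ideal.Quotient.mk M.nicholsIdeal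
      (TensorAlgebra.ι K u * a - M.tensorAct g a * TensorAlgebra.ι K u) := by
  rw [ad, M.glue_apply _ hu]
  rfl

theorem mk_twistedAd {U : Type*} [AddCommGroup U] [Module K U] (M : YetterDrinfeld K G U) {g : G}
    {u : U} (hu : u ∈ M.comp g) (a : TensorAlgebra K U) :
    Ideal.Quotient.mk M.nicholsIdeal (M.twistedAd g u a) =
      M.ad u (Ideal.Quotient.mk M.nicholsIdeal (M.tensorAct g⁻¹ a)) := by
  rw [M.ad_mk hu, ← tensorAct_mul, mul_inv_cancel, tensorAct_one, twistedAd_apply]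

theorem nicholsAct_ad {U : Type*} [AddCommGroup U] [Module K U] (M : YetterDrinfeld K G U)
    (h : G) (u : U) (y : M.NicholsAlgebra) :
    M.nicholsAct h (M.ad u y) = M.ad (M.ρ h u) (M.nicholsAct h y) := by
  refine M.span_homogeneous (p := LinearMap.eqLocus
    ((M.nicholsAct h).toLinearMap ∘ₗ M.ad.flip y) (M.ad.flip (M.nicholsAct h y) ∘ₗ M.ρ h)) ?_ u
  intro g v hv
  obtain ⟨a, rfl⟩ := Ideal.Quotient.mk_surjective y
  simp only [LinearMap.mem_eqLocus, LinearMap.comp_apply, LinearMap.flip_apply,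
    AlgHom.toLinearMap_apply]
  rw [M.ad_mk hv, nicholsAct_mk, nicholsAct_mk, M.ad_mk (M.map_mem h g v hv)]
  congr 1
  simp [tensorAct_ι, ← tensorAct_mul]

/-- Needed because `leftAd` is the adjoint action applied to a translate of `a`. -/
theorem nicholsAct_mem_adPow (M : YetterDrinfeld K G V) (N : YetterDrinfeld K G W) (g : G)
    (n : ℕ) : ∀ y ∈ M.adPow N n, (M.prod N).nicholsAct g y ∈ M.adPow N n := by
  induction n with
  | zero =>
    rintro _ ⟨_, ⟨w, rfl⟩, rfl⟩
    refine ⟨_, ⟨N.ρ g w, rfl⟩, ?_⟩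
    change _ = Ideal.Quotient.mk _ ((M.prod N).tensorAct g _)
    rw [tensorAct_ι]
    simp [prod_ρ_apply]
    rfl
  | succ n ih =>
    suffices h : M.adPow N (n + 1) ≤
        (M.adPow N (n + 1)).comap ((M.prod N).nicholsAct g).toLinearMap from fun y hy => h hy
    refine Submodule.map₂_le.2 ?_
    rintro _ ⟨v, rfl⟩ y hy
    rw [Submodule.mem_comap, AlgHom.toLinearMap_apply, nicholsAct_ad]
    refine Submodule.apply_mem_map₂ _ ⟨M.ρ g v, ?_⟩ (ih y hy)
    simp [prod_ρ_apply]

theorem mk_leftAd_mem_adPow (M : YetterDrinfeld K G V) (N : YetterDrinfeld K G W) {p : G} {v : V}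
    (hv : v ∈ M.comp p) {n : ℕ} {a : TensorAlgebra K (V × W)}
    (ha : Ideal.Quotient.mk (M.prod N).nicholsIdeal a ∈ M.adPow N n) :
    Ideal.Quotient.mk (M.prod N).nicholsIdeal (M.leftAd N p v a) ∈ M.adPow N (n + 1) := by
  rw [leftAd, (M.prod N).mk_twistedAd (M.mem_comp_prod_inl N hv)]
  exact Submodule.apply_mem_map₂ _ ⟨v, rfl⟩ (M.nicholsAct_mem_adPow N p⁻¹ n _ ha)

theorem mk_ι_mem_adPow_zero (M : YetterDrinfeld K G V) (N : YetterDrinfeld K G W) (w : W) :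
    Ideal.Quotient.mk (M.prod N).nicholsIdeal (TensorAlgebra.ι K ((0 : V), w)) ∈ M.adPow N 0 :=
  ⟨_, ⟨w, rfl⟩, rfl⟩

theorem adTrivial_of_adPow_eq_bot (M : YetterDrinfeld K G V) (N : YetterDrinfeld K G W) {n : ℕ}
    {a : TensorAlgebra K (V × W)}
    (ha : Ideal.Quotient.mk (M.prod N).nicholsIdeal a ∈ M.adPow N n)
    (h : M.adPow N (n + 1) = ⊥) (t : G) : M.AdTrivial N t a := by
  intro v hv
  have := M.mk_leftAd_mem_adPow N hv ha
  rwa [h, Submodule.mem_bot, Ideal.Quotient.eq_zero_iff_mem] at this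

/-- If `(ad V)(W) ≠ 0`, then `(ad v)(w) ≠ 0` for some homogeneous elements `v` and `w`. -/
theorem exists_leftAd_notMem (M : YetterDrinfeld K G V) (N : YetterDrinfeld K G W)
    (h : M.adPow N 1 ≠ ⊥) : ∃ r s v w, v ∈ M.comp r ∧ w ∈ N.comp s ∧
      M.leftAd N r v (TensorAlgebra.ι K ((0 : V), w)) ∉ (M.prod N).nicholsIdeal := by
  by_contra! hcon
  apply h
  rw [eq_bot_iff]
  refine Submodule.map₂_le.2 ?_
  rintro _ ⟨v, rfl⟩ _ ⟨_, ⟨w, rfl⟩, rfl⟩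
  rw [Submodule.mem_bot]
  refine M.span_homogeneous (p := LinearMap.ker ((M.prod N).ad.flip
    ((M.prod N).nicholsι (LinearMap.inr K V W w)) ∘ₗ LinearMap.inl K V W)) ?_ v
  intro r v hv
  rw [LinearMap.mem_ker, LinearMap.comp_apply, LinearMap.flip_apply]
  refine N.span_homogeneous (p := LinearMap.ker ((M.prod N).ad (LinearMap.inl K V W v) ∘ₗ
    (M.prod N).nicholsι ∘ₗ LinearMap.inr K V W)) ?_ w
  intro s w hw
  -- The translate `ρ r w` is used so that the twist by `r⁻¹` in `leftAd` returns `w`.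
  have h1 := hcon r _ v _ hv (N.map_mem r s w hw)
  rw [← Ideal.Quotient.eq_zero_iff_mem, leftAd,
    (M.prod N).mk_twistedAd (M.mem_comp_prod_inl N hv), tensorAct_ι, prod_ρ_apply] at h1
  rw [LinearMap.mem_ker]
  change (M.prod N).ad (v, 0) (Ideal.Quotient.mk _ (TensorAlgebra.ι K ((0 : V), w))) = 0
  simpa using h1

end Rigid

end YetterDrinfeld

namespace YetterDrinfeld

/-! ### From commutation outside `F` to bounds for the support. -/

section Bound

variable {K G V W : Type*} [Field K] [Group G] [AddCommGroup V] [Module K V]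
  [AddCommGroup W] [Module K W]

/-- The support of a Yetter-Drinfeld module as a subset of the group. -/
def support (M : YetterDrinfeld K G V) : Set G := {g | M.comp g ≠ ⊥}

theorem conj_mem_support {M : YetterDrinfeld K G V} (h : G) {g : G} (hg : g ∈ M.support) :
    h * g * h⁻¹ ∈ M.support :=
  M.comp_conj_ne_bot h g hg

theorem exists_ne_zero_of_mem_support {M : YetterDrinfeld K G V} {g : G} (hg : g ∈ M.support) :
    ∃ v ∈ M.comp g, v ≠ 0 :=
  Submodule.exists_mem_ne_zero_of_ne_bot hg

/-- The inner group preserves `F` within the support and acts transitively there. -/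
theorem support_subset_of_conj_mem_iff {M : YetterDrinfeld K G V}
    (hind : IsIndecomposable M.Supp) {F : Set G} {f : G} (hf : f ∈ M.support) (hfF : f ∈ F)
    (h : ∀ x ∈ M.support, ∀ y ∈ M.support, y ∈ F ↔ x * y * x⁻¹ ∈ F) : M.support ⊆ F := by
  have key : ∀ σ ∈ Inn M.Supp, ∀ y : M.Supp, y.1 ∈ F ↔ (σ y).1 ∈ F := by
    intro σ hσ
    induction hσ using Subgroup.closure_induction with
    | mem σ hσ =>
      obtain ⟨x, rfl⟩ := hσ
      intro y
      exact h x.1 x.2 y.1 y.2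
    | one => intro y; rfl
    | mul σ τ _ _ h1 h2 => intro y; rw [h2, h1]; rfl
    | inv σ _ h1 =>
      intro y
      rw [h1 (σ⁻¹ y)]
      simp
  intro x hx
  obtain ⟨σ, hσ, e⟩ := hind.2 ⟨f, hf⟩ ⟨x, hx⟩
  have := (key σ hσ ⟨f, hf⟩).1 hfF
  rwa [e] at this

/-- Conjugation is injective, so on a finite set forward stability already gives stability in both
directions. -/
theorem support_subset_of_finite {M : YetterDrinfeld K G V}
    (hind : IsIndecomposable M.Supp) {F : Set G} (hF : F.Finite) {f : G} (hf : f ∈ M.support)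
    (hfF : f ∈ F) (h : ∀ x ∈ M.support, ∀ y ∈ F, x * y * x⁻¹ ∈ F) : M.support ⊆ F := by
  refine support_subset_of_conj_mem_iff hind hf hfF fun x hx y _ => ⟨h x hx y, fun hy => ?_⟩
  have hinj : Set.InjOn (fun y => x * y * x⁻¹) F := fun a _ b _ e => by simpa using e
  have himg : (fun y => x * y * x⁻¹) '' F = F :=
    Set.eq_of_subset_of_ncard_le (Set.image_subset_iff.2 (h x hx))
      hinj.ncard_image.ge hF
  rw [← himg] at hy
  obtain ⟨z, hz, e⟩ := hy
  have : z = y := by simpa using e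
  rwa [← this]

/-- The non-commuting graph of an indecomposable support is connected. -/
theorem support_subset_of_commute {M : YetterDrinfeld K G V}
    (hind : IsIndecomposable M.Supp) {F : Set G} {f : G} (hf : f ∈ M.support) (hfF : f ∈ F)
    (h : ∀ t ∈ M.support, t ∉ F → ∀ f ∈ F, Commute t f) : M.support ⊆ F := by
  refine support_subset_of_conj_mem_iff hind hf hfF fun x hx y hy => ?_
  have hcomm : Commute y x → (y ∈ F ↔ x * y * x⁻¹ ∈ F) := fun e => by
    rw [commute_iff_conj_eq.1 e]
  have hconj : Commute (x * y * x⁻¹) x → Commute y x := fun e => by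
    have := commute_iff_conj_eq.1 e
    rw [commute_iff_conj_eq]
    simpa using this
  -- Two non-commuting elements of the support lie on the same side of `F`. If `y` does not commute
  -- with `x`, neither does `x y x⁻¹`, so all three lie on the same side.
  by_contra hcon
  have hc : ¬ Commute y x := fun e => hcon (hcomm e)
  by_cases hxF : x ∈ F
  · by_cases hyF : y ∈ F
    · exact hcon ⟨fun _ => by_contra fun e => hc (hconj (h _ (conj_mem_support x hy) e x hxF)),
        fun _ => hyF⟩
    · exact hc (h y hy hyF x hxF)
  · by_cases hyF : y ∈ F
    · exact hc (h x hx hxF y hyF).symm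
    · exact hcon ⟨fun e => absurd e hyF, fun e => absurd (hconj (h x hx hxF _ e).symm) hc⟩

/-- Everything else in the support commutes with `h`, so it permutes the only two points `h` moves.
Hence `{a, b}`, together with `a b a⁻¹` when `a` and `b` do not commute, is closed under
conjugation; the second case is the quandle of transpositions of `S₃`. -/
theorem support_subset_of_swap {M : YetterDrinfeld K G V} (hind : IsIndecomposable M.Supp)
    {h a b : G} (ha : a ∈ M.support) (hb : b ∈ M.support) (hne : a ≠ b) (hab : h * a * h⁻¹ = b)
    (hba : h * b * h⁻¹ = a)
    (hfix : ∀ x ∈ M.support, x ≠ a → x ≠ b → h * x * h⁻¹ = x) :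
    M.support ⊆ {a, b, a * b * a⁻¹} := by
  -- Conjugation by `h` takes `z a z⁻¹` to `z b z⁻¹ ≠ z a z⁻¹`, so `z a z⁻¹` is moved by `h` and
  -- must be `a` or `b`.
  have hpres : ∀ z ∈ M.support, z ≠ a → z ≠ b →
      (z * a * z⁻¹ = a ∧ z * b * z⁻¹ = b) ∨ (z * a * z⁻¹ = b ∧ z * b * z⁻¹ = a) := by
    intro z hz hza hzb
    have hzh := hfix z hz hza hzb
    have e1 : h * (z * a * z⁻¹) * h⁻¹ = z * b * z⁻¹ := by
      rw [← hab]
      conv_rhs => rw [← hzh]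
      group
    have e2 : h * (z * b * z⁻¹) * h⁻¹ = z * a * z⁻¹ := by
      rw [← hba]
      conv_rhs => rw [← hzh]
      group
    by_cases h1 : z * a * z⁻¹ = a
    · rw [h1, hab] at e1
      exact Or.inl ⟨h1, e1.symm⟩
    by_cases h2 : z * a * z⁻¹ = b
    · rw [h2, hba] at e1
      exact Or.inr ⟨h2, e1.symm⟩
    exfalso
    rw [hfix _ (conj_mem_support z ha) h1 h2] at e1
    exact hne (by simpa using e1)
  refine support_subset_of_finite hind (Set.toFinite _) ha (by simp) ?_
  by_cases hc : a * b * a⁻¹ = b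
  · have hc' : b * a * b⁻¹ = a := by
      rw [mul_inv_eq_iff_eq_mul] at hc ⊢
      exact hc.symm
    rintro x hx y hy
    have hy' : y = a ∨ y = b := by
      rcases hy with rfl | rfl | rfl
      · exact Or.inl rfl
      · exact Or.inr rfl
      · exact Or.inr hc
    by_cases hxa : x = a
    · subst hxa
      rcases hy' with rfl | rfl <;> simp
    by_cases hxb : x = b
    · subst hxb
      rcases hy' with rfl | rfl <;> simp [hc']
    rcases hpres x hx hxa hxb with ⟨h1, h2⟩ | ⟨h1, h2⟩ <;> rcases hy' with rfl | rfl <;>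
      simp [h1, h2]
  · have hca : a * b * a⁻¹ ≠ a := fun e => by
      rw [mul_inv_eq_iff_eq_mul] at e
      exact hne (mul_left_cancel e).symm
    have hcS := conj_mem_support a hb
    have e1 : b * a * b⁻¹ = a * b * a⁻¹ := by
      have := hfix _ hcS hca hc
      have h5 : h * (a * b * a⁻¹) * h⁻¹ =
          (h * a * h⁻¹) * (h * b * h⁻¹) * (h * a * h⁻¹)⁻¹ := by group
      rw [← this, h5, hab, hba]
    set c := a * b * a⁻¹ with hcdef
    -- If `c` commuted with `a`, then `a b a⁻¹ = c = a c a⁻¹` would force `b = c`.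
    have hswap : c * a * c⁻¹ = b ∧ c * b * c⁻¹ = a := by
      rcases hpres c hcS hca hc with ⟨h1, _⟩ | h1
      · exfalso
        apply hc
        have h2 : a * c * a⁻¹ = c := by
          rw [mul_inv_eq_iff_eq_mul] at h1 ⊢
          exact h1.symm
        have h3 : a * c * a⁻¹ = a * b * a⁻¹ := h2
        simpa using h3
      · exact h1
    have e2 : a * c * a⁻¹ = b := by
      have h3 := hswap.2
      rw [mul_inv_eq_iff_eq_mul] at h3 e1 ⊢
      have h4 : c * b = b * a := e1.symm
      rw [← h3, h4]
    have e3 : b * c * b⁻¹ = a := by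
      have h3 := hswap.1
      rw [mul_inv_eq_iff_eq_mul] at h3 ⊢
      rw [← h3, hcdef]
      group
    rintro x hx y hy
    by_cases hxa : x = a
    · subst hxa
      rcases hy with rfl | rfl | rfl
      · simp
      · simp [c]
      · simp [e2]
    by_cases hxb : x = b
    · subst hxb
      rcases hy with rfl | rfl | rfl
      · simp [e1]
      · simp
      · simp [e3]
    have hxc : x * c * x⁻¹ = (x * a * x⁻¹) * (x * b * x⁻¹) * (x * a * x⁻¹)⁻¹ := by
      rw [hcdef]; group
    rcases hpres x hx hxa hxb with ⟨h1, h2⟩ | ⟨h1, h2⟩ <;> rw [h1, h2] at hxc <;>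
      rcases hy with rfl | rfl | rfl <;> simp [h1, h2, hxc, ← hcdef, e1]

/-- At the last level every `V_t` acts trivially, so rigidity becomes the commutation hypothesis of
`support_subset_of_commute`. -/
theorem IsRigid.support_subset {M : YetterDrinfeld K G V} {N : YetterDrinfeld K G W}
    (hind : IsIndecomposable M.Supp) {n : ℕ} (hn : M.adPow N (n + 1) = ⊥) {h f : G} {F : Set G}
    {a : TensorAlgebra K (V × W)} (H : M.IsRigid N h F a) (hf : f ∈ M.support) (hfF : f ∈ F)
    (ha : Ideal.Quotient.mk (M.prod N).nicholsIdeal a ∈ M.adPow N n) : M.support ⊆ F :=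
  support_subset_of_commute hind hf hfF fun t ht htF =>
    (H.commute t htF ht (M.adTrivial_of_adPow_eq_bot N ha hn t)).2

/-- One more application of the adjoint action determines the support, unless the degree `h`
centralizes the part of the support outside `F`. -/
theorem IsRigid.support_subset_or {M : YetterDrinfeld K G V} {N : YetterDrinfeld K G W}
    (hind : IsIndecomposable M.Supp) {n : ℕ} (hn : M.adPow N (n + 2) = ⊥) {h f : G} {F : Set G}
    {a : TensorAlgebra K (V × W)} (H : M.IsRigid N h F a) (hf : f ∈ M.support) (hfF : f ∈ F)
    (ha : Ideal.Quotient.mk (M.prod N).nicholsIdeal a ∈ M.adPow N n) :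
    M.support ⊆ F ∨ (∃ p ∈ M.support, M.support ⊆ F ∪ {p, h * p * h⁻¹}) ∨
      ∃ t ∈ M.support, t ∉ F ∧ h * t * h⁻¹ = t ∧ ∃ f ∈ F, ¬ Commute t f := by
  by_cases hS : M.support ⊆ F
  · exact Or.inl hS
  refine Or.inr ?_
  by_cases hp : ∃ p ∈ M.support, h * p * h⁻¹ ∉ F ∧ h * p * h⁻¹ ≠ p
  · obtain ⟨p, hp, hpF, hpp⟩ := hp
    obtain ⟨v, hv, hv0⟩ := exists_ne_zero_of_mem_support hp
    exact Or.inl ⟨p, hp, (H.step hv hv0 hpF hpp).support_subset hind hn hf (Or.inl hfF)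
      (M.mk_leftAd_mem_adPow N hv ha)⟩
  · push Not at hp
    refine Or.inr ?_
    by_contra! hcon
    refine hS (support_subset_of_commute hind hf hfF fun t ht htF => hcon t ht htF ?_)
    -- Since `h` carries `h⁻¹ t h` to `t ∉ F`, and no element is moved to a point outside `F`, that
    -- element equals `t`; so `h` fixes `t`.
    have h1 := conj_mem_support h⁻¹ ht
    have h2 := hp _ h1 (by simpa [mul_assoc] using htF)
    have h3 : t = h⁻¹ * t * h⁻¹⁻¹ := by
      rw [← h2]; group
    rw [← h3] at h2
    exact h2

end Bound

end YetterDrinfeld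

namespace YetterDrinfeld

/-! ### The support has at most six elements. -/

section Six

variable {K G V W : Type*} [Field K] [Group G] [AddCommGroup V] [Module K V]
  [AddCommGroup W] [Module K W]

theorem eq_of_conj_eq_conj {h x y : G} (e : h * x * h⁻¹ = h * y * h⁻¹) : x = y :=
  mul_left_cancel (mul_right_cancel e)

/-- After the step with `p`, one more step finishes unless some outside `t` is fixed by `h p` and
fails to commute with the enlarged set. Then `step_fixed` drops `p` and asks for rigidity of the
element obtained from `a` by `t` alone. This comes from `hfix`, `step_entering` or `step`, according
to whether `h` fixes `t`, carries it into `F`, or moves it outside `F`. -/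
theorem IsRigid.support_subset_of_step {M : YetterDrinfeld K G V} {N : YetterDrinfeld K G W}
    (hind : IsIndecomposable M.Supp) {n : ℕ} (hn : M.adPow N (n + 3) = ⊥) {h f p : G} {F : Set G}
    {a : TensorAlgebra K (V × W)} (H : M.IsRigid N h F a) (hf : f ∈ M.support) (hfF : f ∈ F)
    (ha : Ideal.Quotient.mk (M.prod N).nicholsIdeal a ∈ M.adPow N n) (hp : p ∈ M.support)
    (hpF : h * p * h⁻¹ ∉ F) (hpp : h * p * h⁻¹ ≠ p)
    (hfix : ∀ t ∈ M.support, t ∉ F → h * t * h⁻¹ = t → (∃ f ∈ F, ¬ Commute t f) →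
      ∃ e ∈ M.comp t, ∃ g, M.IsRigid N (h * t) (F ∪ {t, g}) (M.leftAd N t e a)) :
    (∃ x y, M.support ⊆ F ∪ {p, h * p * h⁻¹} ∪ {x, y}) ∨
      ∃ t, t ∉ F ∧ h * t * h⁻¹ ∈ F ∧
        M.support ⊆ F ∪ {p, h * p * h⁻¹} ∪ {t} ∪ {x | t * x * t⁻¹ ∈ F} := by
  obtain ⟨v, hv, hv0⟩ := exists_ne_zero_of_mem_support hp
  have H2 := H.step hv hv0 hpF hpp
  have ha2 := M.mk_leftAd_mem_adPow N hv ha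
  rcases H2.support_subset_or hind hn hf (Or.inl hfF) ha2 with h1 | ⟨q, _, hq⟩ |
    ⟨t, ht, htF, hfx, g, hg, hcg⟩
  · exact Or.inl ⟨1, 1, fun x hx => Or.inl (h1 hx)⟩
  · exact Or.inl ⟨_, _, hq⟩
  have htF1 : t ∉ F := fun e => htF (Or.inl e)
  have htp : h * p * h⁻¹ ≠ t := by rintro rfl; simp at htF
  have hc : Commute t (h * p) := commute_iff_conj_eq.2 hfx
  have key : ∀ e ∈ M.comp t, ∀ F', M.IsRigid N (h * t) F' (M.leftAd N t e a) → F ⊆ F' →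
      t ∈ F' → M.support ⊆ F ∪ {p, h * p * h⁻¹} ∪ F' := by
    intro e he F' H' h1 h2
    exact (IsRigid.step_fixed H.mem H.supported hv hv0 hpF hpp he htp hc H' h1 h2).support_subset
      hind hn hf (Or.inl (Or.inl hfF)) (M.mk_leftAd_mem_adPow N he ha2)
  by_cases hht : h * t * h⁻¹ = t
  · have hch : Commute t h := commute_iff_conj_eq.2 hht
    have hcp : Commute t p := by simpa using hch.inv_right.mul_right hc
    -- Fixed by both `h` and `h p`, the element `t` commutes with `p` and `h p h⁻¹`, so the
    -- non-commuting partner is an old one.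
    have hgF : g ∈ F := by
      rcases hg with hg | rfl | rfl
      · exact hg
      · exact absurd hcp hcg
      · exact absurd ((hch.mul_right hcp).mul_right hch.inv_right) hcg
    obtain ⟨e, he, g', H'⟩ := hfix t ht htF1 hht ⟨g, hgF, hcg⟩
    refine Or.inl ⟨t, g', (key e he _ H' Set.subset_union_left (by simp)).trans ?_⟩
    rintro x (hx | hx | hx)
    · exact Or.inl hx
    · exact Or.inl (Or.inl hx)
    · exact Or.inr hx
  obtain ⟨e, he, he0⟩ := exists_ne_zero_of_mem_support ht
  by_cases hhF : h * t * h⁻¹ ∈ F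
  · refine Or.inr ⟨t, htF1, hhF, (key e he _ (H.step_entering he he0 htF1 hht)
      (fun x hx => Or.inl (Or.inl hx)) (by simp)).trans ?_⟩
    rintro x (hx | (hx | rfl | rfl) | hx)
    · exact Or.inl (Or.inl hx)
    · exact Or.inl (Or.inl (Or.inl hx))
    · exact Or.inl (Or.inr rfl)
    · exact Or.inl (Or.inl (Or.inl hhF))
    · exact Or.inr hx
  · refine Or.inl ⟨t, h * t * h⁻¹, (key e he _ (H.step he he0 hhF hht) Set.subset_union_left
      (by simp)).trans ?_⟩
    rintro x (hx | hx | hx)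
    · exact Or.inl hx
    · exact Or.inl (Or.inl hx)
    · exact Or.inr hx

/-- When the supports commute, no step from `W` is available, so the nonvanishing of `(ad V)(W)` has
to supply the element at level one. Its set is the single point `r`, and the two remaining levels
add at most four elements. -/
theorem exists_support_subset_of_commute {M : YetterDrinfeld K G V} {N : YetterDrinfeld K G W}
    (hind : IsIndecomposable M.Supp) (hn : M.adPow N 4 = ⊥)
    (hcomm : ∀ r ∈ M.support, ∀ s ∈ N.support, Commute r s) (h1 : M.adPow N 1 ≠ ⊥) :
    ∃ a b c d e f, M.support ⊆ {a, b, c, d, e, f} := by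
  obtain ⟨r, s, v, w, hv, hw, hne⟩ := M.exists_leftAd_notMem N h1
  have hv0 : v ≠ 0 := by
    rintro rfl
    apply hne
    have e : ((0 : V), (0 : W)) = 0 := rfl
    simp [leftAd, twistedAd_apply, e]
  have hw0 : w ≠ 0 := by
    rintro rfl
    apply hne
    have e : ((0 : V), (0 : W)) = 0 := rfl
    simp [leftAd, twistedAd_apply, e]
  have hr : r ∈ M.support := fun e => hv0 (by rw [e] at hv; exact hv)
  have hs : s ∈ N.support := fun e => hw0 (by rw [e] at hw; exact hw)
  have H0 := M.isRigid_ι N hw ((M.prod N).ι_notMem_nicholsIdeal (by simpa using hw0))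
  have hmem : M.leftAd N r v (TensorAlgebra.ι K ((0 : V), w)) ∈ (M.prod N).tensorComp (s * r) :=
    (M.prod N).twistedAd_mem_tensorComp (M.mem_comp_prod_inl N hv) H0.mem
  have hsupp := H0.supported.leftAd H0.mem hv
  have hrs : s * r * s⁻¹ = r := commute_iff_conj_eq.1 (hcomm r hr s hs)
  have hset : (∅ : Set G) ∪ {r, s * r * s⁻¹} = {r} := by simp [hrs]
  rw [hset] at hsupp
  -- Since `s` centralizes the support of `V`, commuting with `s r` amounts to commuting with `r`.
  have hcr : ∀ t ∈ M.support, Commute t (s * r) → Commute t r := fun t ht hc => by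
    simpa using (hcomm t ht s hs).inv_right.mul_right hc
  have H1 : M.IsRigid N (s * r) {r} (M.leftAd N r v (TensorAlgebra.ι K ((0 : V), w))) := by
    refine ⟨hmem, hne, hsupp, fun t ht ht0 had => ?_⟩
    have hc := M.commute_degree N hmem hne hsupp ht ht0 had
    refine ⟨hc, ?_⟩
    rintro f rfl
    exact hcr t ht0 hc
  have hrr : s * r * r * (s * r)⁻¹ = r := by
    conv_rhs => rw [← hrs]
    group
  by_cases hall : ∀ p ∈ M.support, Commute p r
  · refine ⟨r, r, r, r, r, r, ?_⟩
    simpa using support_subset_of_commute (F := {r}) hind hr rfl fun t ht _ f hf => by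
      rw [Set.mem_singleton_iff.1 hf]; exact hall t ht
  push Not at hall
  obtain ⟨p, hp, hpr⟩ := hall
  have hpF : s * r * p * (s * r)⁻¹ ∉ ({r} : Set G) := by
    intro e
    have e1 : s * r * p * (s * r)⁻¹ = s * r * r * (s * r)⁻¹ := by rw [hrr]; exact e
    exact hpr (eq_of_conj_eq_conj e1 ▸ Commute.refl _)
  rcases H1.support_subset_of_step (n := 1) hind hn hr rfl
    (M.mk_leftAd_mem_adPow N hv (M.mk_ι_mem_adPow_zero N w)) hp hpF
    (fun e => hpr (hcr p hp (commute_iff_conj_eq.2 e)))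
    (fun t ht _ hfx ⟨f, hf, hcf⟩ => absurd (hcr t ht (commute_iff_conj_eq.2 hfx))
      (by rwa [← Set.mem_singleton_iff.1 hf])) with ⟨x, y, hxy⟩ | ⟨t, ht1, ht2, _⟩
  · refine ⟨r, p, s * r * p * (s * r)⁻¹, x, y, y, hxy.trans ?_⟩
    rintro z ((rfl | rfl | rfl) | rfl | rfl) <;> simp
  · exfalso
    have e1 : s * r * t * (s * r)⁻¹ = s * r * r * (s * r)⁻¹ := by rw [hrr]; exact ht2
    exact ht1 (eq_of_conj_eq_conj e1)

/-- Here a step from `W` gives `F = {r, s r s⁻¹}` at level one, and `s r` carries `r` to `s r s⁻¹`.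
The argument divides according to whether `s r` carries `s r s⁻¹` back to `r`. -/
theorem exists_support_subset_of_not_commute {M : YetterDrinfeld K G V}
    {N : YetterDrinfeld K G W} (hind : IsIndecomposable M.Supp) (hn : M.adPow N 4 = ⊥) {r s : G}
    (hr : r ∈ M.support) (hs : s ∈ N.support) (hrs : ¬ Commute r s) :
    ∃ a b c d e f, M.support ⊆ {a, b, c, d, e, f} := by
  obtain ⟨v, hv, hv0⟩ := exists_ne_zero_of_mem_support hr
  obtain ⟨w, hw, hw0⟩ := exists_ne_zero_of_mem_support hs
  have H0 := M.isRigid_ι N hw ((M.prod N).ι_notMem_nicholsIdeal (by simpa using hw0))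
  have hm0 := M.mk_ι_mem_adPow_zero N w
  set x₀ := TensorAlgebra.ι K ((0 : V), w)
  have hne : s * r * s⁻¹ ≠ r := fun e => hrs (commute_iff_conj_eq.2 e)
  have H1 := H0.step hv hv0 (Set.notMem_empty _) hne
  have hm1 := M.mk_leftAd_mem_adPow N hv hm0
  obtain ⟨q, hq⟩ : ∃ q, q = s * r * s⁻¹ := ⟨_, rfl⟩
  rw [← hq, Set.empty_union] at H1
  have hqS : q ∈ M.support := hq ▸ conj_mem_support s hr
  have hrq : s * r * r * (s * r)⁻¹ = q := by rw [hq]; group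
  have hfix : ∀ t ∈ M.support, t ∉ ({r, q} : Set G) → s * r * t * (s * r)⁻¹ = t →
      (∃ f ∈ ({r, q} : Set G), ¬ Commute t f) →
      ∃ e ∈ M.comp t, ∃ g, M.IsRigid N (s * r * t) ({r, q} ∪ {t, g})
        (M.leftAd N t e (M.leftAd N r v x₀)) := by
    rintro t ht htF hfx ⟨f, hf, hcf⟩
    obtain ⟨e, he, he0⟩ := exists_ne_zero_of_mem_support ht
    have hc : Commute t (s * r) := commute_iff_conj_eq.2 hfx
    -- If `s` fixed `t`, then `t` would commute with `r` and `q`. So `t` allows a step directly from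
    -- `W`, from which `step_fixed` borrows.
    have hst : s * t * s⁻¹ ≠ t := by
      intro h1
      have h2 : Commute t s := commute_iff_conj_eq.2 h1
      have h3 : Commute t r := by simpa using h2.inv_right.mul_right hc
      rcases hf with rfl | rfl
      · exact hcf h3
      · rw [hq] at hcf
        exact hcf ((h2.mul_right h3).mul_right h2.inv_right)
    have H := IsRigid.step_fixed H0.mem H0.supported hv hv0 (Set.notMem_empty _) hne he
      (by rw [← hq]; rintro rfl; simp at htF) hc
      (H0.step he he0 (Set.notMem_empty _) hst) (Set.empty_subset _) (by simp)
    rw [← hq, Set.empty_union, Set.empty_union] at H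
    exact ⟨e, he, _, H⟩
  -- If `s r` interchanges `r` and `q`, nothing outside `F` is carried into it, and any further
  -- moved `p` gives `2 + 2 + 2` elements.
  by_cases hqr : s * r * q * (s * r)⁻¹ = r
  · by_cases hall : ∀ x ∈ M.support, x ≠ r → x ≠ q → s * r * x * (s * r)⁻¹ = x
    · have := support_subset_of_swap hind hr hqS (by rw [hq]; exact hne.symm) hrq hqr hall
      exact ⟨r, q, r * q * r⁻¹, r, r, r, this.trans (by rintro z (rfl | rfl | rfl) <;> simp)⟩
    push Not at hall
    obtain ⟨p, hp, hpr, hpq, hpp⟩ := hall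
    have hstable : ∀ x, s * r * x * (s * r)⁻¹ ∈ ({r, q} : Set G) → x = r ∨ x = q := by
      rintro x (hx | hx)
      · exact Or.inr (eq_of_conj_eq_conj (hx.trans hqr.symm))
      · exact Or.inl (eq_of_conj_eq_conj (Eq.trans hx hrq.symm))
    rcases H1.support_subset_of_step (n := 1) hind hn hr (by simp) hm1 hp
      (fun e => (hstable p e).elim hpr hpq) hpp hfix with ⟨x, y, hxy⟩ | ⟨t, ht1, ht2, _⟩
    · refine ⟨r, q, p, s * r * p * (s * r)⁻¹, x, y, hxy.trans ?_⟩
      rintro z (((rfl | rfl) | rfl | rfl) | rfl | rfl) <;> simp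
    · exact absurd (hstable t ht2) (by simpa using ht1)
  · have hqq : s * r * q * (s * r)⁻¹ ≠ q := by
      intro e
      exact hne (hq ▸ eq_of_conj_eq_conj (e.trans hrq.symm))
    -- The step is made with `q`, which already lies in `F` and so adds just one new element. This
    -- saving leaves room for `t` and the two preimages of `r` and `q` in the second alternative.
    rcases H1.support_subset_of_step (n := 1) hind hn hr (by simp) hm1 hqS
      (by simp only [Set.mem_insert_iff, Set.mem_singleton_iff]; tauto) hqq hfix with
      ⟨x, y, hxy⟩ | ⟨t, _, ht2, ht⟩
    · refine ⟨r, q, s * r * q * (s * r)⁻¹, x, y, y, hxy.trans ?_⟩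
      rintro z (((rfl | rfl) | rfl | rfl) | rfl | rfl) <;> simp
    · refine ⟨r, q, s * r * q * (s * r)⁻¹, t, t⁻¹ * r * t, t⁻¹ * q * t, ht.trans ?_⟩
      have hz : ∀ z y, t * z * t⁻¹ = y → z = t⁻¹ * y * t := by
        rintro z _ rfl
        group
      rintro z ((((rfl | rfl) | rfl | rfl) | rfl) | hz' | hz')
      · simp
      · simp
      · simp
      · simp
      · simp
      · simp [hz z r hz']
      · simp [hz z q hz']

/-- If `(ad V)(W) ≠ 0` and `(ad V)⁴(W) = 0`, and if the support of `V` is indecomposable, then it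
has at most six elements. -/
theorem exists_support_subset {M : YetterDrinfeld K G V} {N : YetterDrinfeld K G W}
    (hind : IsIndecomposable M.Supp) (h1 : M.adPow N 1 ≠ ⊥) (hn : M.adPow N 4 = ⊥) :
    ∃ a b c d e f, M.support ⊆ {a, b, c, d, e, f} := by
  by_cases hcomm : ∀ r ∈ M.support, ∀ s ∈ N.support, Commute r s
  · exact exists_support_subset_of_commute hind hn hcomm h1
  · push Not at hcomm
    obtain ⟨r, hr, s, hs, hrs⟩ := hcomm
    exact exists_support_subset_of_not_commute hind hn hr hs hrs

theorem card_supp_le_six {M : YetterDrinfeld K G V} {N : YetterDrinfeld K G W}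
    (hind : IsIndecomposable M.Supp) (h1 : M.adPow N 1 ≠ ⊥) (hn : M.adPow N 4 = ⊥) :
    Finite M.Supp ∧ Nat.card M.Supp ≤ 6 := by
  classical
  obtain ⟨a, b, c, d, e, f, h⟩ := exists_support_subset hind h1 hn
  have h2 : M.support ⊆ (({a, b, c, d, e, f} : Finset G) : Set G) := by simpa using h
  refine ⟨(Finset.finite_toSet _).subset h2, ?_⟩
  calc M.support.ncard ≤ (({a, b, c, d, e, f} : Finset G) : Set G).ncard :=
        Set.ncard_le_ncard h2 (Finset.finite_toSet _)
    _ ≤ 6 := by rw [Set.ncard_coe_finset]; exact Finset.card_le_six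

end Six

end YetterDrinfeld

/-! ### Indecomposable quandles with at most six elements -/

namespace FiniteQuandle

/-- The number with the given octal digits, starting with the lowest one. -/
def encode (l : List ℕ) : ℕ := l.foldr (fun d c => d + 8 * c) 0

/-- The number which encodes a multiplication table with at most eight columns, given by its rows
as a matrix. -/
def encodeTable (R : List (List ℕ)) : ℕ := R.foldr (fun r c => encode r + 8 ^ 8 * c) 0

/-- An entry of an encoded multiplication table. -/
def entry (T x y : ℕ) : ℕ := T / 8 ^ (8 * x + y) % 8

/-- Self-distributivity of a partial table with `k` rows, as far as the last row is concerned. -/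
def consistent (n k T : ℕ) : Bool :=
  (List.range k).all fun x => (List.range k).all fun y =>
    !(x + 1 == k || y + 1 == k || entry T x y + 1 == k) ||
      (Nat.ble k (entry T x y) ||
        (List.range n).all fun w =>
          entry T (entry T x y) (entry T x w) == entry T x (entry T y w))

/-- The encoded permutations which fix `i` and which have `c` fixed points. -/
def candidates (n c i : ℕ) : List ℕ :=
  ((((List.range n).filter fun w => w != i).permutations'.map fun l =>
    l.take i ++ i :: l.drop i).filter fun r =>
      (List.range n).countP (fun w => r.getD w 0 == w) == c).map encode

/-- The set `S` is a proper non-empty subset which is stable under left multiplication. -/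
def stable (n T : ℕ) (S : List ℕ) : Bool :=
  (List.range n).any (fun y => S.contains y) && (List.range n).any (fun y => !S.contains y) &&
    (List.range n).all fun x => (List.range n).all fun y =>
      !S.contains y || S.contains (entry T x y)

/-- Some subsets of `{0, …, 5}` among which `stable` subsets are looked for. -/
def subsets : List (List ℕ) :=
  [[0], [3], [4], [0, 3], [0, 4], [0, 5], [1, 2], [3, 4], [0, 1, 2], [0, 3, 4], [0, 4, 5]]

/-- Backtracking search which verifies that each extension by `m` rows of a partial table with `k`
rows belongs to the list `Ts` or has a stable subset. -/
def search (n c : ℕ) (Ts : List ℕ) : ℕ → ℕ → ℕ → Bool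
  | 0, _, T => Ts.contains T || subsets.any (stable n T)
  | m + 1, k, T => (candidates n c k).all fun r =>
      !consistent n (k + 1) (T + r * 8 ^ (8 * k)) ||
        search n c Ts m (k + 1) (T + r * 8 ^ (8 * k))

/-- The properties of the multiplication of an indecomposable quandle on `Fin n`. -/
structure IsIndecomposableOp {n : ℕ} (op : Fin n → Fin n → Fin n) : Prop where
  idem : ∀ x, op x x = x
  bij : ∀ x, Function.Bijective (op x)
  dist : ∀ x y z, op (op x y) (op x z) = op x (op y z)
  count : ∀ x y, (List.finRange n).countP (fun w => op x w = w) =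
    (List.finRange n).countP (fun w => op y w = w)
  conn : ∀ P : Fin n → Prop, (∃ y, P y) → (∀ x y, P y → P (op x y)) → ∀ z, P z

theorem encode_cons (d : ℕ) (l : List ℕ) : encode (d :: l) = d + 8 * encode l := rfl

theorem encode_lt : ∀ l : List ℕ, (∀ d ∈ l, d < 8) → encode l < 8 ^ l.length
  | [], _ => by simp [encode]
  | d :: l, h => by
    have h1 := encode_lt l fun e he => h e (by simp [he])
    have h2 := h d (by simp)
    rw [encode_cons, List.length_cons, pow_succ]
    omega

/-- Beyond the end of the list both sides are zero, so no bound on `y` is needed. -/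
theorem encode_div_mod : ∀ (l : List ℕ) (_ : ∀ d ∈ l, d < 8) (y : ℕ),
    encode l / 8 ^ y % 8 = l.getD y 0
  | [], _, y => by simp [encode]
  | d :: l, h, 0 => by
    have h2 := h d (by simp)
    rw [encode_cons, pow_zero, Nat.div_one, List.getD_cons_zero]
    omega
  | d :: l, h, y + 1 => by
    have h1 := encode_div_mod l (fun e he => h e (by simp [he])) y
    have h2 := h d (by simp)
    rw [encode_cons, pow_succ', ← Nat.div_div_eq_div_mul, List.getD_cons_succ, ← h1]
    congr 2
    omega

/-- The added row is a multiple of a higher power of eight than the digit being read. -/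
theorem entry_add_of_lt {T r k x y : ℕ} (hx : x < k) (hy : y < 8) :
    entry (T + r * 8 ^ (8 * k)) x y = entry T x y := by
  have h : 8 * k = 8 * x + y + (1 + (8 * k - (8 * x + y + 1))) := by omega
  have h8 : 0 < 8 ^ (8 * x + y) := by positivity
  rw [entry, entry, h, pow_add, ← mul_assoc, mul_right_comm, Nat.add_mul_div_right _ _ h8,
    pow_add 8 1, pow_one, mul_left_comm, Nat.add_mul_mod_self_left]

theorem entry_add_self {T r k y : ℕ} (hT : T < 8 ^ (8 * k)) :
    entry (T + r * 8 ^ (8 * k)) k y = r / 8 ^ y % 8 := by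
  have h8 : 0 < 8 ^ (8 * k) := by positivity
  rw [entry, pow_add, ← Nat.div_div_eq_div_mul, Nat.add_mul_div_right _ _ h8,
    Nat.div_eq_of_lt hT, zero_add]

variable {n : ℕ} {op : Fin n → Fin n → Fin n}

/-- A row of a multiplication table. -/
def row (f : Fin n → Fin n) : List ℕ := (List.finRange n).map fun w => (f w : ℕ)

theorem row_getD (f : Fin n → Fin n) (w : Fin n) : (row f).getD w 0 = f w := by
  simp [row, List.getD_eq_getElem?_getD]

theorem lt_of_mem_row (hn : n ≤ 8) {f : Fin n → Fin n} {d : ℕ} (hd : d ∈ row f) : d < 8 := by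
  obtain ⟨w, -, rfl⟩ := List.mem_map.1 hd
  exact (f w).2.trans_le hn

theorem row_perm (h : IsIndecomposableOp op) (x : Fin n) : (row (op x)).Perm (List.range n) := by
  have h1 := (Equiv.Perm.map_finRange_perm (Equiv.ofBijective _ (h.bij x))).map Fin.val
  simpa [row, Function.comp_def] using h1

theorem encode_row_mem_candidates (h : IsIndecomposableOp op) (x y : Fin n) :
    encode (row (op x)) ∈ candidates n ((List.finRange n).countP (fun w => op y w = w)) x := by
  have hperm := row_perm h x
  have hlen : (x : ℕ) < (row (op x)).length := by simp [row]
  have hx : (row (op x))[(x : ℕ)] = x := by simp [row, h.idem]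
  have h1 : row (op x) = (row (op x)).take x ++ (x : ℕ) :: (row (op x)).drop (x + 1) := by
    conv_lhs => rw [← List.take_append_drop x (row (op x)), List.drop_eq_getElem_cons hlen, hx]
  refine List.mem_map_of_mem ?_
  rw [List.mem_filter, List.mem_map]
  refine ⟨⟨(row (op x)).take x ++ (row (op x)).drop (x + 1), ?_, ?_⟩, ?_⟩
  · have h2 := hperm.nodup_iff.2 List.nodup_range
    rw [h1, List.nodup_middle, List.nodup_cons, List.mem_append, not_or] at h2
    rw [List.mem_permutations']
    have h3 := hperm.filter fun w => w != (x : ℕ)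
    rw [h1, List.filter_append, List.filter_cons_of_neg (by simp),
      List.filter_eq_self.2 (fun a ha => by
        simp only [bne_iff_ne, ne_eq]
        rintro rfl
        exact h2.1.1 ha),
      List.filter_eq_self.2 (fun a ha => by
        simp only [bne_iff_ne, ne_eq]
        rintro rfl
        exact h2.1.2 ha)] at h3
    exact h3
  · have hlen : ((row (op x)).take x).length = x := by simp [row, x.2.le]
    rw [List.take_left' hlen, List.drop_left' hlen, ← h1]
  · have hr : List.range n = (List.finRange n).map Fin.val := by simp
    rw [beq_iff_eq, h.count y x, hr, List.countP_map]
    refine List.countP_congr fun w _ => ?_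
    simp only [Function.comp_apply, row_getD, beq_iff_eq, decide_eq_true_eq, Fin.ext_iff]

/-- The number `T` encodes the first `k` rows of the table of `op`. -/
def Encodes (op : Fin n → Fin n → Fin n) (k T : ℕ) : Prop :=
  T < 8 ^ (8 * k) ∧ ∀ x y : Fin n, (x : ℕ) < k → entry T x y = op x y

theorem Encodes.succ (hn : n ≤ 8) {k T : ℕ} (hT : Encodes op k T) (hk : k < n) :
    Encodes op (k + 1) (T + encode (row (op ⟨k, hk⟩)) * 8 ^ (8 * k)) := by
  have hr : ∀ d ∈ row (op ⟨k, hk⟩), d < 8 := fun d => lt_of_mem_row hn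
  refine ⟨?_, fun x y hx => ?_⟩
  · have h1 : encode (row (op ⟨k, hk⟩)) < 8 ^ 8 :=
      (encode_lt _ hr).trans_le (Nat.pow_le_pow_right (by norm_num) (by simpa [row] using hn))
    have h2 : (encode (row (op ⟨k, hk⟩)) + 1) * 8 ^ (8 * k) ≤ 8 ^ 8 * 8 ^ (8 * k) :=
      Nat.mul_le_mul_right _ h1
    have h3 : 8 ^ (8 * (k + 1)) = 8 ^ 8 * 8 ^ (8 * k) := by rw [← pow_add]; congr 1; ring
    have h4 := hT.1
    rw [h3]
    rw [add_mul, one_mul] at h2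
    omega
  · rcases Nat.lt_succ_iff_lt_or_eq.1 hx with hx | hx
    · rw [entry_add_of_lt hx (y.2.trans_le hn), hT.2 x y hx]
    · obtain rfl : x = ⟨k, hk⟩ := Fin.ext hx
      rw [entry_add_self hT.1, encode_div_mod _ hr, row_getD]

theorem Encodes.consistent (h : IsIndecomposableOp op) {k T : ℕ} (hk : k ≤ n)
    (hT : Encodes op k T) : consistent n k T = true := by
  simp only [FiniteQuandle.consistent, List.all_eq_true, List.mem_range, Bool.or_eq_true,
    beq_iff_eq, Nat.ble_eq]
  intro x hx y hy
  -- The skipping of triples that miss the last row only saves time; the identity holds for all of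
  -- them.
  refine Or.inr ?_
  rcases le_or_gt k (entry T x y) with hz | hz
  · exact Or.inl hz
  refine Or.inr fun w hw => ?_
  obtain ⟨x, rfl⟩ : ∃ x' : Fin n, x' = x := ⟨⟨x, by omega⟩, rfl⟩
  obtain ⟨y, rfl⟩ : ∃ y' : Fin n, y' = y := ⟨⟨y, by omega⟩, rfl⟩
  obtain ⟨w, rfl⟩ : ∃ w' : Fin n, w' = w := ⟨⟨w, hw⟩, rfl⟩
  rw [hT.2 x y hx] at hz ⊢
  rw [hT.2 x w hx, hT.2 y w hy, hT.2 _ _ hz, hT.2 _ _ hx, h.dist]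

theorem Encodes.not_stable (h : IsIndecomposableOp op) {T : ℕ} (hT : Encodes op n T)
    (S : List ℕ) : stable n T S = false := by
  by_contra hS
  simp only [Bool.not_eq_false, stable, Bool.and_eq_true, List.any_eq_true, List.all_eq_true,
    List.mem_range, Bool.or_eq_true, Bool.not_eq_true', List.contains_iff_mem] at hS
  obtain ⟨⟨⟨y, hy, hyS⟩, z, hz, hzS⟩, hst⟩ := hS
  have := h.conn (fun x => (x : ℕ) ∈ S) ⟨⟨y, hy⟩, hyS⟩ (fun x y hy => by
    have := hst x x.2 y y.2
    rw [hT.2 _ _ x.2] at this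
    simpa [hy] using this) ⟨z, hz⟩
  simp [this] at hzS

theorem exists_entry_eq_of_search_aux (hn : n ≤ 8) (h : IsIndecomposableOp op) {c : ℕ} (y : Fin n)
    (hc : (List.finRange n).countP (fun w => op y w = w) = c) {Ts : List ℕ} :
    ∀ m k T : ℕ, k + m = n → Encodes op k T → search n c Ts m k T = true →
      ∃ T ∈ Ts, ∀ x y : Fin n, entry T x y = op x y := by
  intro m
  induction m with
  | zero =>
    intro k T hk hT hs
    obtain rfl : k = n := hk
    -- A complete table of an indecomposable operation has no stable subset, so this leaf must
    -- belong to `Ts`.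
    have h1 : subsets.any (stable k T) = false := by
      simp [List.any_eq_false, hT.not_stable h]
    exact ⟨T, by simpa [search, h1] using hs, fun x y => hT.2 x y x.2⟩
  | succ m ih =>
    intro k T hk hT hs
    have hkn : k < n := by omega
    simp only [search, List.all_eq_true] at hs
    have h1 := hs _ (hc ▸ encode_row_mem_candidates h ⟨k, hkn⟩ y)
    have h2 := hT.succ hn hkn
    rw [h2.consistent h hkn] at h1
    exact ih (k + 1) _ (by omega) h2 (by simpa using h1)

/-- Row zero is prescribed, so the search starts with one row and fills in the other `n`. -/
theorem exists_entry_eq_of_search {n : ℕ} {op : Fin (n + 1) → Fin (n + 1) → Fin (n + 1)}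
    (hn : n + 1 ≤ 8) (h : IsIndecomposableOp op) {r : List ℕ} (hr : row (op 0) = r) {c : ℕ}
    (hc : (List.finRange (n + 1)).countP (fun w => op 0 w = w) = c) {Ts : List ℕ}
    (hs : search (n + 1) c Ts n 1 (encode r) = true) :
    ∃ T ∈ Ts, ∀ x y : Fin (n + 1), entry T x y = op x y := by
  have h0 : Encodes op 0 0 := ⟨by simp, by simp⟩
  have h1 := h0.succ hn (Nat.succ_pos n)
  refine exists_entry_eq_of_search_aux hn h 0 hc n 1 _ (by omega) h1 ?_
  have e : row (op ⟨0, Nat.succ_pos n⟩) = r := hr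
  rw [e]
  simpa using hs

end FiniteQuandle

/-! ### Cycle types of permutations with a fixed point. -/

namespace FiniteQuandle

/-- These are the cycle types of permutations moving at most five points, which is what a left
translation on six points can do, as it fixes its own index. -/
theorem mem_of_sum_le_five {m : Multiset ℕ} (h2 : ∀ a ∈ m, 2 ≤ a) (hs : m.sum ≤ 5) :
    m = 0 ∨ m = {2} ∨ m = {3} ∨ m = {4} ∨ m = {5} ∨ m = {2, 2} ∨ m = {2, 3} := by
  have hc : m.card ≤ 2 := by
    have := Multiset.card_nsmul_le_sum h2
    rw [smul_eq_mul] at this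
    omega
  interval_cases hm : m.card
  · exact Or.inl (Multiset.card_eq_zero.1 hm)
  · obtain ⟨a, rfl⟩ := Multiset.card_eq_one.1 hm
    have := h2 a (by simp)
    rw [Multiset.sum_singleton] at hs
    interval_cases a <;> simp
  · obtain ⟨a, b, rfl⟩ := Multiset.card_eq_two.1 hm
    have ha := h2 a (by simp)
    have hb := h2 b (by simp)
    simp at hs
    have : a ≤ 3 := by omega
    have : b ≤ 3 := by omega
    interval_cases a <;> interval_cases b <;> simp at hs ⊢
    decide

theorem cycleType_formPerm_of_nodup {n : ℕ} {l : List (Fin n)} (hl : l.Nodup)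
    (h2 : 2 ≤ l.length) : l.formPerm.cycleType = {l.length} := by
  rw [(List.isCycle_formPerm hl h2).cycleType, List.support_formPerm_of_nodup l hl,
    List.toFinset_card_of_nodup hl]
  rintro x rfl
  simp at h2

theorem cycleType_formPerm_mul {n : ℕ} (l l' : List (Fin n)) (hl : l.Nodup) (hl' : l'.Nodup)
    (h2 : 2 ≤ l.length) (h2' : 2 ≤ l'.length) (hd : ∀ a ∈ l, a ∉ l') :
    (l.formPerm * l'.formPerm).cycleType = {l.length, l'.length} := by
  rw [((List.formPerm_disjoint_iff hl hl' h2 h2').2 fun a ha => hd a ha).cycleType_mul,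
    cycleType_formPerm_of_nodup hl h2, cycleType_formPerm_of_nodup hl' h2']
  rfl

/-- The permutation `σ` has the same cycle type as a permutation in `l`. -/
def HasNormalForm {n : ℕ} (σ : Equiv.Perm (Fin n)) (l : List (Equiv.Perm (Fin n))) : Prop :=
  ∃ τ ∈ l, σ.cycleType = τ.cycleType

theorem sum_cycleType_lt {n : ℕ} {σ : Equiv.Perm (Fin n)} {i : Fin n} (hi : σ i = i) :
    σ.cycleType.sum + 1 ≤ n := by
  rw [Equiv.Perm.sum_cycleType]
  have h : σ.support ⊂ Finset.univ := by
    rw [Finset.ssubset_univ_iff]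
    intro e
    have := Finset.mem_univ i
    rw [← e, Equiv.Perm.mem_support] at this
    exact this hi
  simpa using Finset.card_lt_card h

theorem hasNormalForm_six (σ : Equiv.Perm (Fin 6)) (i : Fin 6) (hi : σ i = i) :
    HasNormalForm σ [1, List.formPerm [1, 2], List.formPerm [1, 2, 3], List.formPerm [1, 2, 3, 4],
      List.formPerm [1, 2, 3, 4, 5], List.formPerm [1, 2] * List.formPerm [3, 4],
      List.formPerm [1, 2] * List.formPerm [3, 4, 5]] := by
  have h := sum_cycleType_lt hi
  simp only [HasNormalForm, List.mem_cons, List.not_mem_nil, or_false, exists_eq_or_imp,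
    exists_eq_left]
  rcases mem_of_sum_le_five (m := σ.cycleType) (fun _ => Equiv.Perm.two_le_of_mem_cycleType)
    (by omega) with
    e | e | e | e | e | e | e <;> rw [e]
  · exact Or.inl Equiv.Perm.cycleType_one.symm
  all_goals
    simp only [cycleType_formPerm_mul [(1 : Fin 6), 2] [3, 4] (by decide) (by decide) (by decide)
      (by decide) (by decide), cycleType_formPerm_mul [(1 : Fin 6), 2] [3, 4, 5] (by decide)
      (by decide) (by decide) (by decide) (by decide),
      cycleType_formPerm_of_nodup (l := [(1 : Fin 6), 2]) (by decide) (by decide),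
      cycleType_formPerm_of_nodup (l := [(1 : Fin 6), 2, 3]) (by decide) (by decide),
      cycleType_formPerm_of_nodup (l := [(1 : Fin 6), 2, 3, 4]) (by decide) (by decide),
      cycleType_formPerm_of_nodup (l := [(1 : Fin 6), 2, 3, 4, 5]) (by decide) (by decide)]
    simp

theorem hasNormalForm_five (σ : Equiv.Perm (Fin 5)) (i : Fin 5) (hi : σ i = i) :
    HasNormalForm σ [1, List.formPerm [1, 2], List.formPerm [1, 2, 3], List.formPerm [1, 2, 3, 4],
      List.formPerm [1, 2] * List.formPerm [3, 4]] := by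
  have h := sum_cycleType_lt hi
  simp only [HasNormalForm, List.mem_cons, List.not_mem_nil, or_false, exists_eq_or_imp,
    exists_eq_left]
  rcases mem_of_sum_le_five (m := σ.cycleType) (fun _ => Equiv.Perm.two_le_of_mem_cycleType)
    (by omega) with
    e | e | e | e | e | e | e <;> rw [e] at h ⊢ <;> simp at h
  · exact Or.inl Equiv.Perm.cycleType_one.symm
  all_goals
    simp only [cycleType_formPerm_mul [(1 : Fin 5), 2] [3, 4] (by decide) (by decide) (by decide)
      (by decide) (by decide),
      cycleType_formPerm_of_nodup (l := [(1 : Fin 5), 2]) (by decide) (by decide),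
      cycleType_formPerm_of_nodup (l := [(1 : Fin 5), 2, 3]) (by decide) (by decide),
      cycleType_formPerm_of_nodup (l := [(1 : Fin 5), 2, 3, 4]) (by decide) (by decide)]
    simp

theorem hasNormalForm_four (σ : Equiv.Perm (Fin 4)) (i : Fin 4) (hi : σ i = i) :
    HasNormalForm σ [1, List.formPerm [1, 2], List.formPerm [1, 2, 3]] := by
  have h := sum_cycleType_lt hi
  simp only [HasNormalForm, List.mem_cons, List.not_mem_nil, or_false, exists_eq_or_imp,
    exists_eq_left]
  rcases mem_of_sum_le_five (m := σ.cycleType) (fun _ => Equiv.Perm.two_le_of_mem_cycleType)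
    (by omega) with
    e | e | e | e | e | e | e <;> rw [e] at h ⊢ <;> simp at h
  · exact Or.inl Equiv.Perm.cycleType_one.symm
  all_goals
    simp only [
      cycleType_formPerm_of_nodup (l := [(1 : Fin 4), 2]) (by decide) (by decide),
      cycleType_formPerm_of_nodup (l := [(1 : Fin 4), 2, 3]) (by decide) (by decide)]
    simp

theorem hasNormalForm_three (σ : Equiv.Perm (Fin 3)) (i : Fin 3) (hi : σ i = i) :
    HasNormalForm σ [1, List.formPerm [1, 2]] := by
  have h := sum_cycleType_lt hi
  simp only [HasNormalForm, List.mem_cons, List.not_mem_nil, or_false, exists_eq_or_imp,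
    exists_eq_left]
  rcases mem_of_sum_le_five (m := σ.cycleType) (fun _ => Equiv.Perm.two_le_of_mem_cycleType)
    (by omega) with
    e | e | e | e | e | e | e <;> rw [e] at h ⊢ <;> simp at h
  · exact Or.inl Equiv.Perm.cycleType_one.symm
  all_goals
    simp only [cycleType_formPerm_of_nodup (l := [(1 : Fin 3), 2]) (by decide) (by decide)]
    simp

theorem hasNormalForm_two (σ : Equiv.Perm (Fin 2)) (i : Fin 2) (hi : σ i = i) :
    HasNormalForm σ [1] := by
  have h := sum_cycleType_lt hi
  simp only [HasNormalForm, List.mem_cons, List.not_mem_nil, or_false, exists_eq_left]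
  rcases mem_of_sum_le_five (m := σ.cycleType) (fun _ => Equiv.Perm.two_le_of_mem_cycleType)
    (by omega) with
    e | e | e | e | e | e | e <;> rw [e] at h ⊢ <;> simp at h
  exact Equiv.Perm.cycleType_one.symm

/-! ### Relabelling a quandle by an initial segment of the naturals. -/

section Transport

variable {X : Type*} [Quandle X] {n : ℕ}

/-- The multiplication of a quandle, transported to `Fin n`. -/
def transport (e : X ≃ Fin n) (x y : Fin n) : Fin n := e (e.symm x ◃ e.symm y)

theorem inn_map_act {f : Equiv.Perm X} (hf : f ∈ Inn X) (x y : X) : f (x ◃ y) = f x ◃ f y := by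
  induction hf using Subgroup.closure_induction generalizing x y with
  | mem f hf =>
    obtain ⟨z, rfl⟩ := hf
    exact Shelf.self_distrib
  | one => rfl
  | mul f g _ _ h1 h2 => simp only [Equiv.Perm.mul_apply, h2, h1]
  | inv f _ h1 =>
    apply f.injective
    rw [h1]
    simp

/-- Inner permutations are automorphisms, so transitivity makes all left translations conjugate;
`count` keeps only the number of fixed points. In `conn`, finiteness upgrades forward stability to
invariance under the inner group. -/
theorem transport_isIndecomposableOp (hX : IsIndecomposable X) (e : X ≃ Fin n) :
    IsIndecomposableOp (transport e) where
  idem x := by simp [transport, Quandle.fix]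
  bij x := e.bijective.comp ((Rack.act' (e.symm x)).bijective.comp e.symm.bijective)
  dist x y z := by
    simp only [transport, Equiv.symm_apply_apply]
    rw [← Shelf.self_distrib]
  count x y := by
    obtain ⟨f, hf, hxy⟩ := hX.2 (e.symm x) (e.symm y)
    set σ : Equiv.Perm (Fin n) := e.symm.trans (f.trans e)
    rw [← (Equiv.Perm.map_finRange_perm σ).countP_eq (fun w => transport e y w = w),
      List.countP_map]
    refine List.countP_congr fun w _ => ?_
    have h1 : transport e y (σ w) = σ (transport e x w) := by
      simp only [transport, σ, Equiv.trans_apply, Equiv.symm_apply_apply, ← hxy, inn_map_act hf]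
    simp only [Function.comp_apply, decide_eq_true_eq, h1, EmbeddingLike.apply_eq_iff_eq]
  conn P hP hst z := by
    obtain ⟨y, hy⟩ := hP
    obtain ⟨f, hf, hyz⟩ := hX.2 (e.symm y) (e.symm z)
    have hfin : Finite X := Finite.of_equiv _ e.symm
    have key : ∀ f ∈ Inn X, ∀ x, P (e x) ↔ P (e (f x)) := by
      intro f hf
      induction hf using Subgroup.closure_induction with
      | mem f hf =>
        obtain ⟨u, rfl⟩ := hf
        have h1 : ∀ x, P (e x) → P (e (u ◃ x)) := fun x hx => by
          simpa [transport] using hst (e u) _ hx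
        intro x
        refine ⟨h1 x, fun hx => ?_⟩
        have hmaps : Set.MapsTo (fun x => u ◃ x) {x | P (e x)} {x | P (e x)} := h1
        have himg : (fun x => u ◃ x) '' {x | P (e x)} = {x | P (e x)} :=
          Set.eq_of_subset_of_ncard_le hmaps.image_subset
            ((Rack.act' u).injective.injOn.ncard_image).ge (Set.toFinite _)
        have hx' : u ◃ x ∈ (fun x => u ◃ x) '' {x | P (e x)} := by rw [himg]; exact hx
        obtain ⟨x', hx', hxx⟩ := hx'
        rwa [← (Rack.act' u).injective hxx]
      | one => intro x; rfl
      | mul f g _ _ h1 h2 => intro x; rw [h2, h1]; rfl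
      | inv f _ h1 => intro x; rw [h1 (f⁻¹ x)]; simp
    have := (key f hf (e.symm y)).1 (by simpa using hy)
    simpa [hyz] using this

theorem exists_transport_eq {n : ℕ} (hX : Nonempty X) (e₀ : X ≃ Fin (n + 1))
    {l : List (Equiv.Perm (Fin (n + 1)))} (hl : ∀ τ ∈ l, τ 0 = 0)
    (h : ∀ (σ : Equiv.Perm (Fin (n + 1))) (i : Fin (n + 1)), σ i = i → HasNormalForm σ l) :
    ∃ e : X ≃ Fin (n + 1), ∃ τ ∈ l, transport e 0 = τ := by
  obtain ⟨x₀⟩ := hX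
  set σ : Equiv.Perm (Fin (n + 1)) := e₀.symm.trans ((Rack.act' x₀).trans e₀)
  have hσ : ∀ x, σ (e₀ x) = e₀ (x₀ ◃ x) := fun x => by simp [σ]
  obtain ⟨τ, hτ, hc⟩ := h σ (e₀ x₀) (by rw [hσ, Quandle.fix])
  obtain ⟨c, hcc⟩ := isConj_iff.1 (Equiv.Perm.isConj_iff_cycleType_eq.2 hc)
  have h0 := hl τ hτ
  have hci : τ (c (e₀ x₀)) = c (e₀ x₀) := by
    rw [← hcc]
    simp [hσ, Quandle.fix]
  -- Conjugating to `τ` may send the base point to a fixed point of `τ` other than `0`. The swap of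
  -- these two fixed points commutes with `τ`, so it repairs the label without changing the row.
  set s := Equiv.swap 0 (c (e₀ x₀))
  have hs : s * τ = τ * s := by
    have := Equiv.mul_swap_eq_swap_mul τ 0 (c (e₀ x₀))
    rw [h0, hci] at this
    exact this.symm
  refine ⟨e₀.trans (c.trans s), τ, hτ, ?_⟩
  have hx : (e₀.trans (c.trans s)).symm 0 = x₀ := by
    rw [Equiv.symm_apply_eq]
    simp [s]
  funext y
  obtain ⟨x, rfl⟩ := (e₀.trans (c.trans s)).surjective y
  rw [transport, hx, Equiv.symm_apply_apply]
  have e1 : c * σ = τ * c := by rw [← hcc]; group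
  have e2 := congrArg (fun p : Equiv.Perm (Fin (n + 1)) => s (p (e₀ x))) e1
  have e3 := congrArg (fun p : Equiv.Perm (Fin (n + 1)) => p (c (e₀ x))) hs
  simp only [Equiv.Perm.mul_apply, hσ] at e2 e3
  simp only [Equiv.trans_apply]
  rw [e2, e3]

theorem quandleIso_of_entry {Y : Type*} [Quandle Y] (e : X ≃ Fin n) {T : ℕ}
    (hT : ∀ x y : Fin n, entry T x y = transport e x y) (g : Fin n → Y)
    (hg : Function.Bijective g) (h : ∀ x y z : Fin n, entry T x y = z → g z = g x ◃ g y) :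
    QuandleIso X Y := by
  refine ⟨e.trans (Equiv.ofBijective g hg), fun x y => ?_⟩
  have := h (e x) (e y) _ (hT (e x) (e y))
  simpa [transport] using this

end Transport

end FiniteQuandle

namespace FiniteQuandle

/-! ### Identifying the surviving tables. -/

section Isomorphism

variable {X : Type*} [Quandle X] {n : ℕ}

/-- Conjugacy is phrased through explicit conjugators in `H`, which leaves finite statements for the
kernel. -/
theorem quandleIso_conjClass {H : Type*} [Group H] {a : H} (e : X ≃ Fin n) {T : ℕ}
    (hT : ∀ x y : Fin n, entry T x y = transport e x y) (g : Fin n → H)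
    (hinj : Function.Injective g) (hconj : ∀ i, ∃ c, c * a * c⁻¹ = g i)
    (hsurj : ∀ c, ∃ i, g i = c * a * c⁻¹)
    (h : ∀ x y z : Fin n, entry T x y = z → g z = g x * g y * (g x)⁻¹) :
    QuandleIso X (ConjClassQuandle a) := by
  refine quandleIso_of_entry e hT (fun i => ⟨g i, isConj_iff.2 (hconj i)⟩)
    ⟨fun i j hij => hinj (congrArg Subtype.val hij), ?_⟩
    fun x y z hz => Subtype.ext (h x y z hz)
  rintro ⟨b, hb⟩
  obtain ⟨c, rfl⟩ := isConj_iff.1 hb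
  obtain ⟨i, hi⟩ := hsurj c
  exact ⟨i, Subtype.ext hi⟩

theorem quandleIso_aff {m : ℕ} {a : (ZMod m)ˣ} (e : X ≃ Fin n) {T : ℕ}
    (hT : ∀ x y : Fin n, entry T x y = transport e x y) (g : Fin n → ZMod m)
    (hg : Function.Bijective g)
    (h : ∀ x y z : Fin n, entry T x y = z → g z = affAct m a (g x) (g y)) :
    QuandleIso X (Aff m a) :=
  quandleIso_of_entry e hT (Y := Aff m a) g hg h

/-- The table of `(12)^{S₃}`. -/
def tableS3 : ℕ := encodeTable
  [[0, 2, 1], [2, 1, 0], [1, 0, 2]]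

/-- The table of `(123)^{A₄}`. -/
def tableA4 : ℕ := encodeTable
  [[0, 2, 3, 1], [3, 1, 0, 2], [1, 3, 2, 0], [2, 0, 1, 3]]

/-- The table of `Aff(5, 3)`. -/
def tableAff3 : ℕ := encodeTable
  [[0, 2, 3, 4, 1], [2, 1, 4, 0, 3], [3, 4, 2, 1, 0], [4, 0, 1, 3, 2], [1, 3, 0, 2, 4]]

/-- The table of `Aff(5, 2)`. -/
def tableAff2 : ℕ := encodeTable
  [[0, 2, 3, 4, 1], [3, 1, 4, 2, 0], [4, 0, 2, 1, 3], [1, 4, 0, 3, 2], [2, 3, 1, 0, 4]]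

/-- The table of `Aff(5, 4)`. -/
def tableAff4 : ℕ := encodeTable
  [[0, 2, 1, 4, 3], [3, 1, 4, 0, 2], [4, 3, 2, 1, 0], [2, 4, 0, 3, 1], [1, 0, 3, 2, 4]]

/-- The table of `Aff(5, 4)`, in another order. -/
def tableAff4' : ℕ := encodeTable
  [[0, 2, 1, 4, 3], [4, 1, 3, 2, 0], [3, 4, 2, 0, 1], [1, 0, 4, 3, 2], [2, 3, 0, 1, 4]]

/-- The table of `(1234)^{S₄}`. -/
def tableFourCycle : ℕ := encodeTable
  [[0, 2, 3, 4, 1, 5], [4, 1, 0, 3, 5, 2], [1, 5, 2, 0, 4, 3],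
    [2, 1, 5, 3, 0, 4], [3, 0, 2, 5, 4, 1], [0, 4, 1, 2, 3, 5]]

/-- The table of `(12)^{S₄}`. -/
def tableSwap : ℕ := encodeTable
  [[0, 2, 1, 4, 3, 5], [2, 1, 0, 3, 5, 4], [1, 0, 2, 5, 4, 3],
    [4, 1, 5, 3, 0, 2], [3, 5, 2, 0, 4, 1], [0, 4, 3, 2, 1, 5]]

/-- The table of `(12)^{S₄}`, in another order. -/
def tableSwap' : ℕ := encodeTable
  [[0, 2, 1, 4, 3, 5], [2, 1, 0, 5, 4, 3], [1, 0, 2, 3, 5, 4],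
    [4, 5, 2, 3, 0, 1], [3, 1, 5, 0, 4, 2], [0, 3, 4, 1, 2, 5]]

open Equiv in
theorem quandleIso_of_tableS3 (e : X ≃ Fin 3)
    (hT : ∀ x y : Fin 3, entry tableS3 x y = transport e x y) :
    QuandleIso X (ConjClassQuandle (Equiv.swap (0 : Fin 3) 1)) :=
  quandleIso_conjClass e hT
    (![swap 1 2, swap 0 1, swap 0 2] : Fin 3 → Perm (Fin 3))
    (by decide +kernel) (by decide +kernel) (by decide +kernel) (by decide +kernel)

open Equiv in
theorem quandleIso_of_tableA4 (e : X ≃ Fin 4)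
    (hT : ∀ x y : Fin 4, entry tableA4 x y = transport e x y) :
    QuandleIso X (ConjClassQuandle threeCycleA4) :=
  quandleIso_conjClass e hT
    ![⟨swap 1 3 * swap 3 2, Perm.mem_alternatingGroup.2 (by decide)⟩,
      ⟨swap 0 1 * swap 1 2, Perm.mem_alternatingGroup.2 (by decide)⟩,
      ⟨swap 0 3 * swap 3 1, Perm.mem_alternatingGroup.2 (by decide)⟩,
      ⟨swap 0 2 * swap 2 3, Perm.mem_alternatingGroup.2 (by decide)⟩]
    (by decide +kernel) (by decide +kernel) (by decide +kernel) (by decide +kernel)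

open Equiv in
theorem quandleIso_of_tableFourCycle (e : X ≃ Fin 6)
    (hT : ∀ x y : Fin 6, entry tableFourCycle x y = transport e x y) :
    QuandleIso X (ConjClassQuandle (finRotate 4)) :=
  quandleIso_conjClass e hT
    (![swap 0 1 * swap 1 2 * swap 2 3, swap 0 1 * swap 1 3 * swap 3 2,
        swap 0 3 * swap 3 1 * swap 1 2, swap 0 2 * swap 2 3 * swap 3 1,
        swap 0 2 * swap 2 1 * swap 1 3, swap 0 3 * swap 3 2 * swap 2 1] : Fin 6 → Perm (Fin 4))
    (by decide +kernel) (by decide +kernel) (by decide +kernel) (by decide +kernel)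

open Equiv in
theorem quandleIso_of_tableSwap (e : X ≃ Fin 6)
    (hT : ∀ x y : Fin 6, entry tableSwap x y = transport e x y) :
    QuandleIso X (ConjClassQuandle (Equiv.swap (0 : Fin 4) 1)) :=
  quandleIso_conjClass e hT
    (![swap 2 3, swap 1 2, swap 1 3, swap 0 3, swap 0 2, swap 0 1] : Fin 6 → Perm (Fin 4))
    (by decide +kernel) (by decide +kernel) (by decide +kernel) (by decide +kernel)

-- A prescribed first row determines the labels only up to its centralizer. This table differs from
-- `tableSwap` by interchanging the labels 3 and 4, and the images of `g` are exchanged accordingly.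
open Equiv in
theorem quandleIso_of_tableSwap' (e : X ≃ Fin 6)
    (hT : ∀ x y : Fin 6, entry tableSwap' x y = transport e x y) :
    QuandleIso X (ConjClassQuandle (Equiv.swap (0 : Fin 4) 1)) :=
  quandleIso_conjClass e hT
    (![swap 2 3, swap 1 2, swap 1 3, swap 0 2, swap 0 3, swap 0 1] : Fin 6 → Perm (Fin 4))
    (by decide +kernel) (by decide +kernel) (by decide +kernel) (by decide +kernel)

/-- Row zero is multiplication by `a`, so the labels 1 to 4 follow the orbit of 1, here the powers
of 2. -/
theorem quandleIso_of_tableAff2 (e : X ≃ Fin 5)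
    (hT : ∀ x y : Fin 5, entry tableAff2 x y = transport e x y) :
    QuandleIso X (Aff 5 (ZMod.unitOfCoprime 2 (by decide))) :=
  quandleIso_aff e hT ![0, 1, 2, 4, 3] (by decide +kernel) (by decide +kernel)

theorem quandleIso_of_tableAff3 (e : X ≃ Fin 5)
    (hT : ∀ x y : Fin 5, entry tableAff3 x y = transport e x y) :
    QuandleIso X (Aff 5 (ZMod.unitOfCoprime 3 (by decide))) :=
  quandleIso_aff e hT ![0, 1, 3, 4, 2] (by decide +kernel) (by decide +kernel)

theorem quandleIso_of_tableAff4 (e : X ≃ Fin 5)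
    (hT : ∀ x y : Fin 5, entry tableAff4 x y = transport e x y) :
    QuandleIso X (Aff 5 (ZMod.unitOfCoprime 4 (by decide))) :=
  quandleIso_aff e hT ![0, 1, 4, 2, 3] (by decide +kernel) (by decide +kernel)

theorem quandleIso_of_tableAff4' (e : X ≃ Fin 5)
    (hT : ∀ x y : Fin 5, entry tableAff4' x y = transport e x y) :
    QuandleIso X (Aff 5 (ZMod.unitOfCoprime 4 (by decide))) :=
  quandleIso_aff e hT ![0, 1, 4, 3, 2] (by decide +kernel) (by decide +kernel)

end Isomorphism

/-! ### The search, for each cardinality and each cycle type of a left translation. -/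

section Classification

variable {X : Type*} [Quandle X]

set_option maxRecDepth 100000 in
theorem not_isIndecomposable_of_card_two (hX : IsIndecomposable X) (e₀ : X ≃ Fin 2) :
    False := by
  obtain ⟨e, τ, hτ, he⟩ := exists_transport_eq hX.1 e₀ (by decide) hasNormalForm_two
  have hI := transport_isIndecomposableOp hX e
  simp only [List.mem_cons, List.not_mem_nil, or_false] at hτ
  subst hτ
  obtain ⟨T, hm, hT⟩ := exists_entry_eq_of_search (by decide) hI (r := [0, 1]) (c := 2)
    (Ts := []) (by rw [he]; decide +kernel) (by simp only [he]; decide +kernel)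
    (by decide +kernel)
  simp at hm

set_option maxRecDepth 100000 in
theorem quandleIso_of_card_three (hX : IsIndecomposable X) (e₀ : X ≃ Fin 3) :
    QuandleIso X (ConjClassQuandle (Equiv.swap (0 : Fin 3) 1)) := by
  obtain ⟨e, τ, hτ, he⟩ := exists_transport_eq hX.1 e₀ (by decide) hasNormalForm_three
  have hI := transport_isIndecomposableOp hX e
  simp only [List.mem_cons, List.not_mem_nil, or_false] at hτ
  rcases hτ with rfl | rfl
  · obtain ⟨T, hm, hT⟩ := exists_entry_eq_of_search (by decide) hI (r := [0, 1, 2]) (c := 3)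
      (Ts := []) (by rw [he]; decide +kernel) (by simp only [he]; decide +kernel)
      (by decide +kernel)
    simp at hm
  · obtain ⟨T, hm, hT⟩ := exists_entry_eq_of_search (by decide) hI (r := [0, 2, 1]) (c := 1)
      (Ts := [tableS3]) (by rw [he]; decide +kernel) (by simp only [he]; decide +kernel)
      (by decide +kernel)
    obtain rfl := List.mem_singleton.1 hm
    exact quandleIso_of_tableS3 e hT

set_option maxRecDepth 100000 in
theorem quandleIso_of_card_four (hX : IsIndecomposable X) (e₀ : X ≃ Fin 4) :
    QuandleIso X (ConjClassQuandle threeCycleA4) := by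
  obtain ⟨e, τ, hτ, he⟩ := exists_transport_eq hX.1 e₀ (by decide) hasNormalForm_four
  have hI := transport_isIndecomposableOp hX e
  simp only [List.mem_cons, List.not_mem_nil, or_false] at hτ
  rcases hτ with rfl | rfl | rfl
  · obtain ⟨T, hm, hT⟩ := exists_entry_eq_of_search (by decide) hI (r := [0, 1, 2, 3]) (c := 4)
      (Ts := []) (by rw [he]; decide +kernel) (by simp only [he]; decide +kernel)
      (by decide +kernel)
    simp at hm
  · obtain ⟨T, hm, hT⟩ := exists_entry_eq_of_search (by decide) hI (r := [0, 2, 1, 3]) (c := 2)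
      (Ts := []) (by rw [he]; decide +kernel) (by simp only [he]; decide +kernel)
      (by decide +kernel)
    simp at hm
  · obtain ⟨T, hm, hT⟩ := exists_entry_eq_of_search (by decide) hI (r := [0, 2, 3, 1]) (c := 1)
      (Ts := [tableA4]) (by rw [he]; decide +kernel) (by simp only [he]; decide +kernel)
      (by decide +kernel)
    obtain rfl := List.mem_singleton.1 hm
    exact quandleIso_of_tableA4 e hT

-- A four-cycle as left translation yields `Aff(5,2)` and `Aff(5,3)`, a double transposition yields
-- `Aff(5,4)` in two labellings, and the other types yield nothing.
set_option maxRecDepth 100000 in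
theorem quandleIso_of_card_five (hX : IsIndecomposable X) (e₀ : X ≃ Fin 5) :
    QuandleIso X (Aff 5 (ZMod.unitOfCoprime 2 (by decide))) ∨
      QuandleIso X (Aff 5 (ZMod.unitOfCoprime 3 (by decide))) ∨
      QuandleIso X (Aff 5 (ZMod.unitOfCoprime 4 (by decide))) := by
  obtain ⟨e, τ, hτ, he⟩ := exists_transport_eq hX.1 e₀ (by decide) hasNormalForm_five
  have hI := transport_isIndecomposableOp hX e
  simp only [List.mem_cons, List.not_mem_nil, or_false] at hτ
  rcases hτ with rfl | rfl | rfl | rfl | rfl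
  · obtain ⟨T, hm, hT⟩ := exists_entry_eq_of_search (by decide) hI (r := [0, 1, 2, 3, 4]) (c := 5)
      (Ts := []) (by rw [he]; decide +kernel) (by simp only [he]; decide +kernel)
      (by decide +kernel)
    simp at hm
  · obtain ⟨T, hm, hT⟩ := exists_entry_eq_of_search (by decide) hI (r := [0, 2, 1, 3, 4]) (c := 3)
      (Ts := []) (by rw [he]; decide +kernel) (by simp only [he]; decide +kernel)
      (by decide +kernel)
    simp at hm
  · obtain ⟨T, hm, hT⟩ := exists_entry_eq_of_search (by decide) hI (r := [0, 2, 3, 1, 4]) (c := 2)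
      (Ts := []) (by rw [he]; decide +kernel) (by simp only [he]; decide +kernel)
      (by decide +kernel)
    simp at hm
  · obtain ⟨T, hm, hT⟩ := exists_entry_eq_of_search (by decide) hI (r := [0, 2, 3, 4, 1]) (c := 1)
      (Ts := [tableAff2, tableAff3]) (by rw [he]; decide +kernel) (by simp only [he]; decide +kernel)
      (by decide +kernel)
    simp only [List.mem_cons, List.not_mem_nil, or_false] at hm
    rcases hm with rfl | rfl
    · exact Or.inl (quandleIso_of_tableAff2 e hT)
    · exact Or.inr (Or.inl (quandleIso_of_tableAff3 e hT))
  · obtain ⟨T, hm, hT⟩ := exists_entry_eq_of_search (by decide) hI (r := [0, 2, 1, 4, 3]) (c := 1)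
      (Ts := [tableAff4, tableAff4']) (by rw [he]; decide +kernel) (by simp only [he]; decide +kernel)
      (by decide +kernel)
    simp only [List.mem_cons, List.not_mem_nil, or_false] at hm
    rcases hm with rfl | rfl
    · exact Or.inr (Or.inr (quandleIso_of_tableAff4 e hT))
    · exact Or.inr (Or.inr (quandleIso_of_tableAff4' e hT))

-- Only two of the seven types survive: a four-cycle gives the four-cycles of `S₄`, and a double
-- transposition gives its transpositions.
set_option maxRecDepth 100000 in
theorem quandleIso_of_card_six (hX : IsIndecomposable X) (e₀ : X ≃ Fin 6) :
    QuandleIso X (ConjClassQuandle (Equiv.swap (0 : Fin 4) 1)) ∨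
      QuandleIso X (ConjClassQuandle (finRotate 4)) := by
  obtain ⟨e, τ, hτ, he⟩ := exists_transport_eq hX.1 e₀ (by decide) hasNormalForm_six
  have hI := transport_isIndecomposableOp hX e
  simp only [List.mem_cons, List.not_mem_nil, or_false] at hτ
  rcases hτ with rfl | rfl | rfl | rfl | rfl | rfl | rfl
  · obtain ⟨T, hm, hT⟩ := exists_entry_eq_of_search (by decide) hI (r := [0, 1, 2, 3, 4, 5]) (c := 6)
      (Ts := []) (by rw [he]; decide +kernel) (by simp only [he]; decide +kernel)
      (by decide +kernel)
    simp at hm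
  · obtain ⟨T, hm, hT⟩ := exists_entry_eq_of_search (by decide) hI (r := [0, 2, 1, 3, 4, 5]) (c := 4)
      (Ts := []) (by rw [he]; decide +kernel) (by simp only [he]; decide +kernel)
      (by decide +kernel)
    simp at hm
  · obtain ⟨T, hm, hT⟩ := exists_entry_eq_of_search (by decide) hI (r := [0, 2, 3, 1, 4, 5]) (c := 3)
      (Ts := []) (by rw [he]; decide +kernel) (by simp only [he]; decide +kernel)
      (by decide +kernel)
    simp at hm
  · obtain ⟨T, hm, hT⟩ := exists_entry_eq_of_search (by decide) hI (r := [0, 2, 3, 4, 1, 5]) (c := 2)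
      (Ts := [tableFourCycle]) (by rw [he]; decide +kernel) (by simp only [he]; decide +kernel)
      (by decide +kernel)
    obtain rfl := List.mem_singleton.1 hm
    exact Or.inr (quandleIso_of_tableFourCycle e hT)
  · obtain ⟨T, hm, hT⟩ := exists_entry_eq_of_search (by decide) hI (r := [0, 2, 3, 4, 5, 1]) (c := 1)
      (Ts := []) (by rw [he]; decide +kernel) (by simp only [he]; decide +kernel)
      (by decide +kernel)
    simp at hm
  · obtain ⟨T, hm, hT⟩ := exists_entry_eq_of_search (by decide) hI (r := [0, 2, 1, 4, 3, 5]) (c := 2)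
      (Ts := [tableSwap, tableSwap']) (by rw [he]; decide +kernel) (by simp only [he]; decide +kernel)
      (by decide +kernel)
    simp only [List.mem_cons, List.not_mem_nil, or_false] at hm
    rcases hm with rfl | rfl
    · exact Or.inl (quandleIso_of_tableSwap e hT)
    · exact Or.inl (quandleIso_of_tableSwap' e hT)
  · obtain ⟨T, hm, hT⟩ := exists_entry_eq_of_search (by decide) hI (r := [0, 2, 1, 4, 5, 3]) (c := 1)
      (Ts := []) (by rw [he]; decide +kernel) (by simp only [he]; decide +kernel)
      (by decide +kernel)
    simp at hm

end Classification

end FiniteQuandle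

theorem mainTheorem9 {K G V W : Type*} [Field K] [Group G]
    [AddCommGroup V] [Module K V] [AddCommGroup W] [Module K W]
    (M : YetterDrinfeld K G V) (N : YetterDrinfeld K G W)
    (hind : IsIndecomposable M.Supp)
    (h1 : M.adPow N 1 ≠ ⊥) (h4 : M.adPow N 4 = ⊥) :
    QuandleIso M.Supp Unit ∨
    QuandleIso M.Supp (ConjClassQuandle (Equiv.swap (0 : Fin 3) 1)) ∨
    QuandleIso M.Supp (ConjClassQuandle (Equiv.swap (0 : Fin 4) 1)) ∨
    QuandleIso M.Supp (ConjClassQuandle threeCycleA4) ∨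
    QuandleIso M.Supp (Aff 5 (ZMod.unitOfCoprime 2 (by decide))) ∨
    QuandleIso M.Supp (Aff 5 (ZMod.unitOfCoprime 3 (by decide))) ∨
    QuandleIso M.Supp (Aff 5 (ZMod.unitOfCoprime 4 (by decide))) ∨
    QuandleIso M.Supp (ConjClassQuandle (finRotate 4)) := by
  obtain ⟨hfin, hcard⟩ := YetterDrinfeld.card_supp_le_six hind h1 h4
  obtain ⟨n, hn⟩ : ∃ n, Nat.card M.Supp = n := ⟨_, rfl⟩
  have e : M.Supp ≃ Fin n := Finite.equivFinOfCardEq hn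
  rw [hn] at hcard
  interval_cases n
  · exact (hind.1.elim fun x => (e x).elim0)
  · exact Or.inl ⟨e.trans (Equiv.ofUnique _ _), fun _ _ => rfl⟩
  · exact (FiniteQuandle.not_isIndecomposable_of_card_two hind e).elim
  · exact Or.inr (Or.inl (FiniteQuandle.quandleIso_of_card_three hind e))
  · have := FiniteQuandle.quandleIso_of_card_four hind e
    tauto
  · have := FiniteQuandle.quandleIso_of_card_five hind e
    tauto
  · have := FiniteQuandle.quandleIso_of_card_six hind e
    tauto
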